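/- Let $n\ge 1$. A permutation $\pi=\pi_1\cdots\pi_{2n}$ of the multiset $\{1,1,2,2,\dots,n,n\}$ is \emph{nonnesting} if it avoids the patterns $1221$ and $2112$. Here a word $w_1\cdots w_m$ \emph{contains} a pattern $p=p_1\cdots p_k$ if there are indices $i_1<\dots<i_k$ such that, for all $r,s$, $w_{i_r}<w_{i_s}$ if and only if $p_r<p_s$, and $w_{i_r}=w_{i_s}$ if and only if $p_r=p_s$; otherwise $w$ \emph{avoids} $p$. For a set $\Lambda$ of words, let $\mathcal{C}_n(\Lambda)$ be the set of nonnesting permutations of $\{1,1,\dots,n,n\}$ that avoid every pattern in $\Lambda$; for $\Sigma\subseteq\mathcal{S}_3$, let $\mathcal{S}_n(\Sigma)$ be the set of permutations in $\mathcal{S}_n$ that avoid every pattern in $\Sigma$. Let $\operatorname{des}(w_1\cdots w_m)=|\{i: 1\le i<m,\ w_i>w_{i+1}\}|$ be the number of descents, and let $N_n(t)=\sum_{d=0}^{n-1}\frac1n\binom{n}{d}\binom{n}{d+1}t^d$ be the Narayana polynomial. Theorem. Let $\Sigma\subseteq\mathcal{S}_3$ and $\Lambda=\{\sigma_1\sigma_2\sigma_2\sigma_3:\sigma_1\sigma_2\sigma_3\in\Sigma\}$.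 Then, for every $n\ge1$, $$\sum_{\pi\in\mathcal{C}_n(\Lambda)} t^{\operatorname{des}(\pi)}=N_n(t)\sum_{\hat\pi\in\mathcal{S}_n(\Sigma)} t^{\operatorname{des}(\hat\pi)}.$$ In particular, for every $n\ge1$, $$\sum_{\pi\in\mathcal{C}_n(1332)} t^{\operatorname{des}(\pi)}=N_n(t)^2.$$ -/

import Mathlib

open Polynomial

namespace NonnestingPerm

/-- A word `w` of length `m` contains the pattern `p` of length `k` if some subsequence of `w`
(at increasing positions `f 0 < f 1 < ⋯`) is in the same relative order as `p`, equal letters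
of `p` corresponding to equal letters of `w`. -/
def Contains {α β : Type*} [LinearOrder α] [LinearOrder β] {m k : ℕ}
    (w : Fin m → α) (p : Fin k → β) : Prop :=
  ∃ f : Fin k ↪o Fin m, ∀ r s : Fin k,
    (w (f r) < w (f s) ↔ p r < p s) ∧ (w (f r) = w (f s) ↔ p r = p s)

/-- `w` avoids the pattern `p`. -/
def Avoids {α β : Type*} [LinearOrder α] [LinearOrder β] {m k : ℕ}
    (w : Fin m → α) (p : Fin k → β) : Prop :=
  ¬ Contains w p

/-- The number of descents of a word: the number of `i` with `w i > w (i + 1)`. -/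
def des {α : Type*} [LinearOrder α] {m : ℕ} (w : Fin m → α) : ℕ :=
  Finset.card {i : Fin m | ∃ h : (i : ℕ) + 1 < m, w ⟨(i : ℕ) + 1, h⟩ < w i}

/-- `π` is a permutation of the multiset `{1, 1, 2, 2, …, n, n}`: each letter occurs exactly
twice. The letters `1, …, n` are represented by the elements `0, …, n - 1` of `Fin n`. -/
def IsDoublePerm {n : ℕ} (π : Fin (2 * n) → Fin n) : Prop :=
  ∀ l : Fin n, Finset.card {i : Fin (2 * n) | π i = l} = 2

/-- A nonnesting permutation of `{1, 1, 2, 2, …, n, n}`: one that avoids `1221` and `2112`. -/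
def IsNonnesting {n : ℕ} (π : Fin (2 * n) → Fin n) : Prop :=
  IsDoublePerm π ∧ Avoids π (![1, 2, 2, 1] : Fin 4 → ℕ) ∧ Avoids π (![2, 1, 1, 2] : Fin 4 → ℕ)

open Classical in
/-- `𝒞ₙ(Λ)`: the nonnesting permutations of `{1, 1, …, n, n}` that avoid every pattern in `Λ`. -/
noncomputable def nonnestingAvoiding {β : Type*} [LinearOrder β] {k : ℕ} (n : ℕ)
    (Λ : Set (Fin k → β)) : Finset (Fin (2 * n) → Fin n) :=
  {π | IsNonnesting π ∧ ∀ p ∈ Λ, Avoids π p}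

open Classical in
/-- `𝒮ₙ(S)`: the permutations in `𝒮ₙ` that avoid every permutation in `S ⊆ 𝒮ₖ`. A permutation
`τ` is identified with the word `τ 0, τ 1, …` (one-line notation). -/
noncomputable def permAvoiding {k : ℕ} (n : ℕ) (S : Set (Equiv.Perm (Fin k))) :
    Finset (Equiv.Perm (Fin n)) :=
  {τ | ∀ σ ∈ S, Avoids (τ : Fin n → Fin n) (σ : Fin k → Fin k)}

/-- The word `σ₁σ₂σ₂σ₃` obtained from `σ = σ₁σ₂σ₃ ∈ 𝒮₃` by doubling the middle letter. -/
def doubleMiddle (σ : Equiv.Perm (Fin 3)) : Fin 4 → Fin 3 :=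
  ![σ 0, σ 1, σ 1, σ 2]

/-- The Narayana polynomial `Nₙ(t) = ∑_{d=0}^{n-1} (1/n) * binom(n, d) * binom(n, d+1) * t^d`
(used for `n ≥ 1`). -/
noncomputable def narayana (n : ℕ) : ℚ[X] :=
  ∑ d ∈ Finset.range n, C ((1 / (n : ℚ)) * (n.choose d : ℚ) * (n.choose (d + 1) : ℚ)) * X ^ d

end NonnestingPerm

/-! A nonnesting permutation is a shuffle of two copies of one permutation `τ`: first copies and
second copies of the letters occur in the same order. It thus amounts to `τ` together with a linear
extension of the rectangle `Fin n × Bool` (`exists_shuffleWord_eq`, `shuffleWord_injective`), and it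
contains `σ₁σ₂σ₂σ₃` iff `τ` contains `σ` (`contains_doubleMiddle_iff`).

For fixed `τ`, the descents of the shuffle are those of the linear extension under `shuffleLabel τ`.
By the fundamental lemma of `(P, ω)`-partitions, their distribution is determined by the number of
compatible maps with values below `m`, for all `m`. Subtracting from such a map the number of
descents of `τ` before each column gives a weakly increasing map with values below `m - des τ`. The
distribution is therefore `X ^ des τ` times the one for a natural labelling
(`sum_linExt_shuffleLabel`), a factor independent of `τ` otherwise.

Under the natural labelling, linear extensions are Dyck words, counted by valleys. Binary trees turn
this count into `treePoly`, whose quadratic functional equation yields the three-term recurrence of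
the Narayana polynomials (`treePoly_eq_narayana`). The same trees encode `132`-avoiding permutations
by descents, whence the square for `1332`. -/

namespace NonnestingPerm

/-! ### `(P, ω)`-partitions and their fundamental lemma. -/

/-- The condition defining `(P, ω)`-partitions: `f` is weakly increasing, and strictly increasing
where the labels decrease. -/
def IsCompat {α L : Type*} [PartialOrder α] [LinearOrder L] (ω : α → L) (f : α → ℕ) : Prop :=
  ∀ x y, x < y → toLex (f x, ω x) < toLex (f y, ω y)

open Classical in
/-- The `(P, ω)`-partitions with values less than `m`. -/
noncomputable def compatFinset {α L : Type*} [Fintype α] [PartialOrder α] [LinearOrder L]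
    (ω : α → L) (m : ℕ) : Finset (α → ℕ) :=
  {f ∈ Fintype.piFinset fun _ => Finset.range m | IsCompat ω f}

open Classical in
/-- The weakly increasing functions with values less than `m`. -/
noncomputable def monoFinset (α : Type*) [Fintype α] [PartialOrder α] (m : ℕ) :
    Finset (α → ℕ) :=
  {f ∈ Fintype.piFinset fun _ => Finset.range m | Monotone f}

open Classical in
/-- The linear extensions of `α`, as enumerations. -/
noncomputable def linExt (α : Type*) [Fintype α] [PartialOrder α] (N : ℕ) :
    Finset (Fin N ≃ α) :=
  {e | StrictMono e.symm}

/-- With `equiv_eq_of_strictMono`: an injective key sorts a finite type in exactly one way. This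
attaches a unique linear extension to each `(P, ω)`-partition, and later a unique `τ` to each
nonnesting permutation. -/
theorem exists_equiv_strictMono {β K : Type*} [Fintype β] [LinearOrder K] {N : ℕ}
    (hN : Fintype.card β = N) {key : β → K} (hkey : Function.Injective key) :
    ∃ e : Fin N ≃ β, StrictMono (key ∘ e) := by
  let e₀ : Fin N ≃ β := (Fintype.equivFinOfCardEq hN).symm
  let σ := Tuple.sort (key ∘ e₀)
  refine ⟨σ.trans e₀, ?_⟩
  exact (Tuple.monotone_sort (key ∘ e₀)).strictMono_of_injective
    ((hkey.comp e₀.injective).comp σ.injective)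

theorem equiv_eq_of_strictMono {β K : Type*} [LinearOrder K] {N : ℕ} {key : β → K}
    (hkey : Function.Injective key) {e e' : Fin N ≃ β} (h : StrictMono (key ∘ e))
    (h' : StrictMono (key ∘ e')) : e = e' := by
  have := (StrictMono.range_inj h h').1 (by rw [e.surjective.range_comp, e'.surjective.range_comp])
  ext k
  exact hkey (congrFun this k)

section

variable {α L : Type*} [Fintype α] [PartialOrder α] [LinearOrder L]

theorem mem_compatFinset {ω : α → L} {m : ℕ} {f : α → ℕ} :
    f ∈ compatFinset ω m ↔ (∀ x, f x < m) ∧ IsCompat ω f := by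
  simp [compatFinset]

theorem mem_monoFinset {m : ℕ} {f : α → ℕ} :
    f ∈ monoFinset α m ↔ (∀ x, f x < m) ∧ Monotone f := by
  simp [monoFinset]

theorem mem_linExt {N : ℕ} {e : Fin N ≃ α} : e ∈ linExt α N ↔ StrictMono e.symm := by
  simp [linExt]

/-- The fundamental lemma of `(P, ω)`-partitions. -/
theorem card_compatFinset_eq_sum {N : ℕ} (hN : Fintype.card α = N) {ω : α → L}
    (hω : Function.Injective ω) (m : ℕ) :
    (compatFinset ω m).card = ∑ e ∈ linExt α N, (compatFinset (ω ∘ e) m).card := by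
  rw [← Finset.card_sigma]
  symm
  -- Sorting `α` by the value of `f`, ties broken by label, gives the linear extension to which `f`
  -- belongs.
  have hkey (f : α → ℕ) : Function.Injective fun x => toLex (f x, ω x) := by
    intro x y h
    exact hω (Prod.ext_iff.1 (toLex.injective h)).2
  have hsm {e : Fin N ≃ α} {a : Fin N → ℕ} (h : IsCompat (ω ∘ e) a) :
      StrictMono ((fun x => toLex ((a ∘ e.symm) x, ω x)) ∘ e) := by
    intro i j hij
    simpa using h i j hij
  refine Finset.card_bij (fun p _ => p.2 ∘ p.1.symm) ?_ ?_ ?_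
  · rintro ⟨e, a⟩ h
    simp only [Finset.mem_sigma, mem_linExt, mem_compatFinset] at h ⊢
    refine ⟨fun x => h.2.1 _, fun x y hxy => ?_⟩
    simpa using h.2.2 _ _ (h.1 hxy)
  · rintro ⟨e, a⟩ h ⟨e', a'⟩ h' heq
    simp only [Finset.mem_sigma, mem_linExt, mem_compatFinset] at h h' heq
    have h1 := hsm h.2.2
    have h2 := hsm h'.2.2
    rw [← heq] at h2
    obtain rfl := equiv_eq_of_strictMono (hkey _) h1 h2
    obtain rfl : a = a' := by
      ext i
      simpa using congrFun heq (e i)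
    rfl
  · intro f hf
    rw [mem_compatFinset] at hf
    obtain ⟨e, he⟩ := exists_equiv_strictMono hN (hkey f)
    refine ⟨⟨e, f ∘ e⟩, ?_, by ext x; simp⟩
    simp only [Finset.mem_sigma, mem_linExt, mem_compatFinset]
    refine ⟨fun x y hxy => ?_, fun i => hf.1 _, fun i j hij => he hij⟩
    have := hf.2 x y hxy
    rw [← he.lt_iff_lt]
    simpa using this

end

/-! ### Labelled chains: removing the forced increases at descents. -/

section

variable {L : Type*} [LinearOrder L] {n : ℕ}

/-- The number of descents of `w` before position `i`. -/
def descentsBefore (w : Fin (n + 1) → L) (i : Fin (n + 1)) : ℕ :=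
  ∑ k : Fin n, if k.castSucc < i ∧ w k.succ < w k.castSucc then 1 else 0

theorem des_eq_sum (w : Fin (n + 1) → L) :
    des w = ∑ k : Fin n, if w k.succ < w k.castSucc then 1 else 0 := by
  rw [des, Finset.card_filter, Fin.sum_univ_castSucc]
  simp
  rfl

theorem descentsBefore_last (w : Fin (n + 1) → L) : descentsBefore w (Fin.last n) = des w := by
  simp [descentsBefore, des_eq_sum, Fin.castSucc_lt_last]

theorem descentsBefore_zero (w : Fin (n + 1) → L) : descentsBefore w 0 = 0 := by
  simp [descentsBefore]

theorem descentsBefore_succ (w : Fin (n + 1) → L) (k : Fin n) :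
    descentsBefore w k.succ =
      descentsBefore w k.castSucc + if w k.succ < w k.castSucc then 1 else 0 := by
  have : (if w k.succ < w k.castSucc then 1 else 0) =
      ∑ j : Fin n, if j = k then (if w k.succ < w k.castSucc then 1 else 0) else 0 := by simp
  rw [this, descentsBefore, descentsBefore, ← Finset.sum_add_distrib]
  refine Finset.sum_congr rfl fun j _ => ?_
  rcases lt_trichotomy j k with h | rfl | h
  · have h1 : j.castSucc < k.succ := Fin.castSucc_lt_succ_iff.2 h.le
    have h2 : j.castSucc < k.castSucc := h
    simp [h1, h2, h.ne]
  · simp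
  · have h1 : ¬ j.castSucc < k.succ := by simpa [Fin.castSucc_lt_succ_iff] using h
    have h2 : ¬ j.castSucc < k.castSucc := not_lt.2 h.le
    simp [h1, h2, h.ne']

theorem descentsBefore_mono (w : Fin (n + 1) → L) : Monotone (descentsBefore w) := by
  rw [Fin.monotone_iff_le_succ]
  intro i
  rw [descentsBefore_succ]
  exact Nat.le_add_right _ _

theorem descentsBefore_le (w : Fin (n + 1) → L) (i) : descentsBefore w i ≤ des w :=
  descentsBefore_last w ▸ descentsBefore_mono w (Fin.le_last i)

theorem isCompat_fin_iff {w : Fin (n + 1) → L} (hw : Function.Injective w)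
    {a : Fin (n + 1) → ℕ} :
    IsCompat w a ↔ ∀ k : Fin n,
      a k.castSucc + (if w k.succ < w k.castSucc then 1 else 0) ≤ a k.succ := by
  have : IsCompat w a ↔ StrictMono fun i => toLex (a i, w i) := Iff.rfl
  rw [this, Fin.strictMono_iff_lt_succ]
  refine forall_congr' fun k => ?_
  have hne : w k.castSucc ≠ w k.succ := hw.ne (Fin.castSucc_lt_succ (i := k)).ne
  rw [Prod.Lex.toLex_lt_toLex]
  rcases hne.lt_or_gt with h | h
  · rw [if_neg h.not_gt]
    exact ⟨fun h' => h'.elim (fun h' => h'.le) (fun h' => h'.1.le),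
      fun h' => h'.lt_or_eq.imp id fun h' => ⟨h', h⟩⟩
  · rw [if_pos h]
    exact ⟨fun h' => h'.elim id (fun h' => absurd h'.2 h.not_gt), Or.inl⟩

/-- `descentsBefore w` is the least compatible map, so subtracting it from any other involves no
truncation. -/
theorem IsCompat.descentsBefore_le {w : Fin (n + 1) → L} (hw : Function.Injective w)
    {a : Fin (n + 1) → ℕ} (ha : IsCompat w a) (i : Fin (n + 1)) : descentsBefore w i ≤ a i := by
  rw [isCompat_fin_iff hw] at ha
  induction i using Fin.induction with
  | zero => simp [descentsBefore_zero]
  | succ k ih =>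
    rw [descentsBefore_succ]
    have := ha k
    omega

theorem isCompat_add_descentsBefore {w : Fin (n + 1) → L} (hw : Function.Injective w)
    {b : Fin (n + 1) → ℕ} : IsCompat w (b + descentsBefore w) ↔ Monotone b := by
  rw [isCompat_fin_iff hw, Fin.monotone_iff_le_succ]
  refine forall_congr' fun k => ?_
  simp only [Pi.add_apply, descentsBefore_succ]
  omega

theorem card_compatFinset_fin {w : Fin (n + 1) → L} (hw : Function.Injective w) (m : ℕ) :
    (compatFinset w m).card = (monoFinset (Fin (n + 1)) (m - des w)).card := by
  symm
  refine Finset.card_bij (fun b _ => b + descentsBefore w) ?_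
    (fun _ _ _ _ h => add_right_cancel h) ?_
  · intro b hb
    rw [mem_monoFinset] at hb
    rw [mem_compatFinset, isCompat_add_descentsBefore hw]
    refine ⟨fun i => ?_, hb.2⟩
    have := hb.1 i
    have := descentsBefore_le w i
    simp only [Pi.add_apply]
    omega
  · intro a ha
    rw [mem_compatFinset] at ha
    have hab : (a - descentsBefore w) + descentsBefore w = a := by
      ext i
      have := ha.2.descentsBefore_le hw i
      simp; omega
    refine ⟨a - descentsBefore w, ?_, hab⟩
    have hm : Monotone (a - descentsBefore w) := by
      rw [← isCompat_add_descentsBefore hw, hab]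
      exact ha.2
    refine mem_monoFinset.2 ⟨fun i => ?_, hm⟩
    -- The bound need only be checked at the top element, where exactly `des w` is subtracted.
    refine (hm (Fin.le_last i)).trans_lt ?_
    have h1 := ha.2.descentsBefore_le hw (Fin.last n)
    have h2 := ha.1 (Fin.last n)
    rw [descentsBefore_last] at h1
    simp only [Pi.sub_apply, descentsBefore_last]
    omega

/-! ### Labellings of the rectangle `Fin n × Bool`. -/

/-- The labelling of `Fin n × Bool` that makes linear extensions have the descents of the
corresponding shuffle of two copies of `τ`. -/
def shuffleLabel {K : Type*} {n : ℕ} (τ : Fin n → K) (x : Fin n × Bool) : K ×ₗ Bool := toLex (τ x.1, x.2)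

theorem shuffleLabel_injective {K : Type*} {n : ℕ} {τ : Fin n → K} (hτ : Function.Injective τ) :
    Function.Injective (shuffleLabel τ) := by
  rintro ⟨i, a⟩ ⟨j, b⟩ h
  have := Prod.ext_iff.1 (toLex.injective h)
  exact Prod.ext (hτ this.1) this.2

/-- Across columns the labels compare as `τ` does, whatever the rows; within a column they increase,
so the inequality there is weak. The relation of `(i, false)` to `(j, true)` for `i < j` follows by
passing through `(i, true)`. -/
theorem isCompat_shuffleLabel {n : ℕ} {τ : Fin n → L} (hτ : Function.Injective τ)
    {f : Fin n × Bool → ℕ} :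
    IsCompat (shuffleLabel τ) f ↔
      (∀ b, IsCompat τ fun i => f (i, b)) ∧ ∀ i, f (i, false) ≤ f (i, true) := by
  have key (i j : Fin n) (a b : Bool) (hij : i < j) :
      toLex (f (i, a), shuffleLabel τ (i, a)) < toLex (f (j, b), shuffleLabel τ (j, b)) ↔
        toLex (f (i, a), τ i) < toLex (f (j, b), τ j) := by
    have := hτ.ne hij.ne
    simp [Prod.Lex.toLex_lt_toLex, shuffleLabel, this]
  constructor
  · intro h
    refine ⟨fun b i j hij => (key i j b b hij).1 (h _ _ ?_), fun i => ?_⟩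
    · exact Prod.mk_lt_mk.2 (Or.inl ⟨hij, le_rfl⟩)
    · have := h (i, false) (i, true) (Prod.mk_lt_mk.2 (Or.inr ⟨le_rfl, by decide⟩))
      rw [Prod.Lex.toLex_lt_toLex] at this
      rcases this with h | h
      · exact h.le
      · exact h.1.le
  · rintro ⟨h1, h2⟩ ⟨i, a⟩ ⟨j, b⟩ hxy
    have hle := hxy.le
    rw [Prod.mk_le_mk] at hle
    rcases hle.1.lt_or_eq with hij | rfl
    · rw [key i j a b hij]
      have := h1 b i j hij
      have hab : f (i, a) ≤ f (i, b) := by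
        rcases a with _ | _ <;> rcases b with _ | _
        · exact le_rfl
        · exact h2 i
        · exact absurd hle.2 (by decide)
        · exact le_rfl
      rw [Prod.Lex.toLex_lt_toLex] at this ⊢
      rcases this with h | h
      · exact Or.inl (hab.trans_lt h)
      · simp only at h ⊢
        rcases hab.lt_or_eq with h' | h'
        · exact Or.inl (h'.trans_eq h.1)
        · exact Or.inr ⟨h'.trans h.1, h.2⟩
    · have hab : a < b := by
        rcases hle.2.lt_or_eq with h | rfl
        · exact h
        · exact absurd hxy (lt_irrefl _)
      obtain ⟨rfl, rfl⟩ : a = false ∧ b = true := by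
        clear hxy hle
        revert a b
        decide
      rw [Prod.Lex.toLex_lt_toLex]
      rcases (h2 i).lt_or_eq with h | h
      · exact Or.inl h
      · refine Or.inr ⟨h, ?_⟩
        simp [Prod.Lex.toLex_lt_toLex, shuffleLabel]

theorem monotone_prod_bool_iff {n : ℕ} {f : Fin n × Bool → ℕ} :
    Monotone f ↔ (∀ b, Monotone fun i => f (i, b)) ∧ ∀ i, f (i, false) ≤ f (i, true) := by
  rw [monotone_prod_iff]
  simp only [and_comm (a := ∀ a, Monotone fun b => f (a, b))]
  refine and_congr_right fun _ => forall_congr' fun i => ⟨fun h => h (by decide), fun h a b hab => ?_⟩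
  rcases a with _ | _ <;> rcases b with _ | _
  · exact le_rfl
  · exact h
  · exact absurd hab (by decide)
  · exact le_rfl

theorem isCompat_shuffleLabel_add {τ : Fin (n + 1) → L} (hτ : Function.Injective τ)
    {g : Fin (n + 1) × Bool → ℕ} :
    IsCompat (shuffleLabel τ) (g + descentsBefore τ ∘ Prod.fst) ↔ Monotone g := by
  rw [isCompat_shuffleLabel hτ, monotone_prod_bool_iff]
  refine and_congr (forall_congr' fun b => ?_) (forall_congr' fun i => ?_)
  · exact isCompat_add_descentsBefore hτ
  · simp

/-- The same shift serves both rows, since it depends on the column alone and leaves the comparison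
inside a column unchanged. The greatest element `(Fin.last n, true)` controls the bound. -/
theorem card_compatFinset_shuffleLabel {τ : Fin (n + 1) → L} (hτ : Function.Injective τ) (m : ℕ) :
    (compatFinset (shuffleLabel τ) m).card =
      (monoFinset (Fin (n + 1) × Bool) (m - des τ)).card := by
  symm
  refine Finset.card_bij (fun b _ => b + descentsBefore τ ∘ Prod.fst) ?_
    (fun _ _ _ _ h => add_right_cancel h) ?_
  · intro b hb
    rw [mem_monoFinset] at hb
    rw [mem_compatFinset, isCompat_shuffleLabel_add hτ]
    refine ⟨fun i => ?_, hb.2⟩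
    have := hb.1 i
    have := descentsBefore_le τ i.1
    simp only [Pi.add_apply, Function.comp_apply]
    omega
  · intro a ha
    rw [mem_compatFinset] at ha
    have hle (x : Fin (n + 1) × Bool) : descentsBefore τ x.1 ≤ a x :=
      ((((isCompat_shuffleLabel hτ).1 ha.2).1 x.2).descentsBefore_le hτ x.1)
    have hab : (a - descentsBefore τ ∘ Prod.fst) + descentsBefore τ ∘ Prod.fst = a := by
      ext i
      have := hle i
      simp; omega
    refine ⟨a - descentsBefore τ ∘ Prod.fst, ?_, hab⟩
    have hm : Monotone (a - descentsBefore τ ∘ Prod.fst) := by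
      rw [← isCompat_shuffleLabel_add hτ, hab]
      exact ha.2
    refine mem_monoFinset.2 ⟨fun i => ?_, hm⟩
    have hi : i ≤ (Fin.last n, true) := Prod.mk_le_mk.2 ⟨Fin.le_last _, Bool.le_true _⟩
    refine (hm hi).trans_lt ?_
    have h1 := hle (Fin.last n, true)
    have h2 := ha.1 (Fin.last n, true)
    rw [descentsBefore_last] at h1
    simp only [Pi.sub_apply, Function.comp_apply, descentsBefore_last]
    omega

/-- A labelling of `Fin n × Bool` that is compatible with the order. -/
def naturalLabel (n : ℕ) (x : Fin n × Bool) : Bool ×ₗ Fin n := toLex (x.2, x.1)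

theorem naturalLabel_injective (n : ℕ) : Function.Injective (naturalLabel n) := by
  rintro ⟨i, a⟩ ⟨j, b⟩ h
  have := Prod.ext_iff.1 (toLex.injective h)
  exact Prod.ext this.2 this.1

theorem naturalLabel_strictMono (n : ℕ) : StrictMono (naturalLabel n) := by
  rintro ⟨i, a⟩ ⟨j, b⟩ h
  rw [naturalLabel, naturalLabel, Prod.Lex.toLex_lt_toLex]
  rcases Prod.mk_lt_mk.1 h with ⟨h1, h2⟩ | ⟨h1, h2⟩
  · rcases h2.lt_or_eq with h2 | h2
    · exact Or.inl h2
    · exact Or.inr ⟨h2, h1⟩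
  · exact Or.inl h2

theorem compatFinset_naturalLabel (n m : ℕ) :
    compatFinset (naturalLabel n) m = monoFinset (Fin n × Bool) m := by
  ext f
  rw [mem_compatFinset, mem_monoFinset]
  refine and_congr_right fun _ => ?_
  rw [monotone_iff_forall_lt]
  refine forall_congr' fun x => forall_congr' fun y => forall_congr' fun h => ?_
  rw [Prod.Lex.toLex_lt_toLex, le_iff_lt_or_eq]
  simp [naturalLabel_strictMono n h]

end

/-! ### From counts of bounded maps to descent polynomials. -/

theorem monoFinset_zero_card (n : ℕ) : (monoFinset (Fin (n + 1)) 0).card = 0 := by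
  rw [Finset.card_eq_zero, Finset.eq_empty_iff_forall_notMem]
  intro f hf
  exact absurd ((mem_monoFinset.1 hf).1 0) (Nat.not_lt_zero _)

theorem monoFinset_one_card (n : ℕ) : (monoFinset (Fin (n + 1)) 1).card = 1 := by
  rw [Finset.card_eq_one]
  refine ⟨0, Finset.eq_singleton_iff_unique_mem.2 ⟨mem_monoFinset.2 ⟨by simp, monotone_const⟩, ?_⟩⟩
  intro f hf
  ext i
  have := (mem_monoFinset.1 hf).1 i
  simp; omega

/-- Multiplication by `X ^ f i` translates the sequence; `B 0 = 0` makes truncated subtraction agree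
with the vanishing of coefficients below `f i`. -/
theorem coeff_sum_X_pow_mul {ι : Type*} (s : Finset ι) (f : ι → ℕ) (B : ℕ → ℕ) (hB₀ : B 0 = 0)
    (m : ℕ) :
    PowerSeries.coeff m (((∑ i ∈ s, (X : ℚ[X]) ^ f i : ℚ[X]) : PowerSeries ℚ) *
      PowerSeries.mk fun k => (B k : ℚ)) = ((∑ i ∈ s, B (m - f i) : ℕ) : ℚ) := by
  rw [← Polynomial.coeToPowerSeries.ringHom_apply, map_sum, Finset.sum_mul, map_sum]
  push_cast
  refine Finset.sum_congr rfl fun i _ => ?_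
  rw [map_pow, Polynomial.coeToPowerSeries.ringHom_apply, Polynomial.coe_X,
    PowerSeries.coeff_X_pow_mul']
  split_ifs with hd
  · simp
  · rw [Nat.sub_eq_zero_of_le (not_le.1 hd).le, hB₀, Nat.cast_zero]

/-- A generating polynomial is determined by the sums of the translates of a sequence. -/
theorem sum_X_pow_eq_of_sum_translate_eq {ι κ : Type*} (s : Finset ι) (t : Finset κ) (f : ι → ℕ)
    (g : κ → ℕ) (B : ℕ → ℕ) (hB₀ : B 0 = 0) (hB₁ : B 1 = 1)
    (h : ∀ m, ∑ i ∈ s, B (m - f i) = ∑ j ∈ t, B (m - g j)) :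
    ∑ i ∈ s, (X : ℚ[X]) ^ f i = ∑ j ∈ t, (X : ℚ[X]) ^ g j := by
  let P : PowerSeries ℚ := PowerSeries.mk fun k => (B k : ℚ)
  have hP : P ≠ 0 := by
    intro h0
    have := congrArg (PowerSeries.coeff 1) h0
    simp [P, hB₁] at this
  apply Polynomial.coe_injective ℚ
  apply mul_right_cancel₀ hP
  ext m
  rw [coeff_sum_X_pow_mul s f B hB₀, coeff_sum_X_pow_mul t g B hB₀, h]

/-- The distribution of descents over the shuffles of two copies of `τ` depends on `τ` only
through its number of descents. -/
theorem sum_linExt_shuffleLabel {L : Type*} [LinearOrder L] {n : ℕ} (hn : 1 ≤ n)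
    {τ : Fin n → L} (hτ : Function.Injective τ) :
    ∑ e ∈ linExt (Fin n × Bool) (2 * n), (X : ℚ[X]) ^ des (shuffleLabel τ ∘ e) =
      X ^ des τ * ∑ e ∈ linExt (Fin n × Bool) (2 * n), (X : ℚ[X]) ^ des (naturalLabel n ∘ e) := by
  obtain ⟨n, rfl⟩ := Nat.exists_eq_add_of_le' hn
  rw [Finset.mul_sum]
  simp only [← pow_add]
  have hc : Fintype.card (Fin (n + 1) × Bool) = 2 * (n + 1) := by simp [mul_comm]
  refine sum_X_pow_eq_of_sum_translate_eq _ _ _ _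
    (fun k => (monoFinset (Fin (2 * n + 1 + 1)) k).card)
    (monoFinset_zero_card _) (monoFinset_one_card _) fun m => ?_
  have h1 := card_compatFinset_eq_sum hc (shuffleLabel_injective hτ) m
  have h2 := card_compatFinset_eq_sum hc (naturalLabel_injective (n + 1)) (m - des τ)
  -- Both sums now count the same weakly increasing maps on the rectangle, with values below `m -
  -- des τ`.
  rw [card_compatFinset_shuffleLabel hτ, ← compatFinset_naturalLabel, h2] at h1
  have h3 (e : Fin (2 * (n + 1)) ≃ Fin (n + 1) × Bool) (m : ℕ) :
      (compatFinset (shuffleLabel τ ∘ e) m).card =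
        (monoFinset (Fin (2 * n + 1 + 1)) (m - des (shuffleLabel τ ∘ e))).card :=
    card_compatFinset_fin (n := 2 * n + 1) ((shuffleLabel_injective hτ).comp e.injective) m
  have h4 (e : Fin (2 * (n + 1)) ≃ Fin (n + 1) × Bool) (m : ℕ) :
      (compatFinset (naturalLabel (n + 1) ∘ e) m).card =
        (monoFinset (Fin (2 * n + 1 + 1)) (m - des (naturalLabel (n + 1) ∘ e))).card :=
    card_compatFinset_fin (n := 2 * n + 1) ((naturalLabel_injective _).comp e.injective) m
  simp only [h3, h4, Nat.sub_sub] at h1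
  exact h1.symm

/-! ### Binary trees by nonempty right subtrees, and the Narayana polynomials. -/

/-- The number of nodes of a binary tree, as many as have a nonempty right subtree. -/
def rightCount : BinaryTree Unit → ℕ
  | .nil => 0
  | .node _ l r => rightCount l + rightCount r + if r.numNodes = 0 then 0 else 1

/-- The generating polynomial of binary trees with `n` nodes by the number of nodes with a
nonempty right subtree. -/
noncomputable def treePoly (n : ℕ) : ℚ[X] :=
  ∑ T ∈ BinaryTree.treesOfNumNodesEq n, X ^ rightCount T

theorem treePoly_zero : treePoly 0 = 1 := by
  simp [treePoly, rightCount]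

theorem treePoly_succ (n : ℕ) :
    treePoly (n + 1) = ∑ ij ∈ Finset.HasAntidiagonal.antidiagonal n,
      treePoly ij.1 * (treePoly ij.2 * if ij.2 = 0 then 1 else X) := by
  rw [treePoly, BinaryTree.treesOfNumNodesEq_succ, Finset.sum_biUnion]
  · refine Finset.sum_congr rfl fun ij _ => ?_
    rw [Finset.sum_map, Finset.sum_product, treePoly, treePoly, Finset.sum_mul]
    refine Finset.sum_congr rfl fun l _ => ?_
    rw [Finset.sum_mul, Finset.mul_sum]
    refine Finset.sum_congr rfl fun r hr => ?_
    rw [BinaryTree.mem_treesOfNumNodesEq] at hr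
    change X ^ rightCount (BinaryTree.node () l r) = _
    rw [rightCount, hr, pow_add, pow_add]
    split_ifs <;> ring
  · simp_rw [Set.PairwiseDisjoint, Set.Pairwise, Finset.disjoint_left]
    aesop

/-- The quadratic equation for the generating function of `treePoly`. -/
theorem mk_treePoly_eq :
    PowerSeries.mk treePoly = 1 + PowerSeries.X * (PowerSeries.mk treePoly *
      (1 + PowerSeries.C (X : ℚ[X]) * (PowerSeries.mk treePoly - 1))) := by
  ext1 n
  rcases n with _ | n
  · simp [treePoly_zero]
  · rw [map_add, PowerSeries.coeff_succ_X_mul, PowerSeries.coeff_mul, PowerSeries.coeff_mk,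
      treePoly_succ]
    rw [PowerSeries.coeff_one, if_neg (Nat.succ_ne_zero n), zero_add]
    refine Finset.sum_congr rfl fun ij _ => ?_
    rw [PowerSeries.coeff_mk, map_add, PowerSeries.coeff_C_mul, map_sub, PowerSeries.coeff_mk,
      PowerSeries.coeff_one]
    split_ifs with h
    · rw [h, treePoly_zero]
      ring
    · ring

/-- The three term recurrence satisfied by the coefficients of a power series `F` with
`F = 1 + x F (1 + t (F - 1))`. -/
theorem recurrence_of_quadratic {R : Type*} [CommRing R] [IsDomain R] [CharZero R] {t : R}
    (ht : t ≠ 0) {f : ℕ → R}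
    (h : PowerSeries.mk f = 1 + PowerSeries.X * (PowerSeries.mk f *
      (1 + PowerSeries.C t * (PowerSeries.mk f - 1)))) (m : ℕ) :
    ((m : R) + 3) * f (m + 2) =
      (2 * m + 3) * (1 + t) * f (m + 1) - m * (1 - t) ^ 2 * f m := by
  set F := PowerSeries.mk f with hF
  set x : PowerSeries R := PowerSeries.X with hx
  -- The equation reads `t x F² + ((1 - t) x - 1) F + 1 = 0`. `G` is the derivative of its left side
  -- in `F`, hence a square root of the discriminant.
  set G := PowerSeries.C (2 * t) * (x * F) + PowerSeries.C (1 - t) * x - 1 with hG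
  have hsq : G ^ 2 = 1 - PowerSeries.C (2 * (1 + t)) * x +
      PowerSeries.C ((1 - t) ^ 2) * x ^ 2 := by
    rw [hG]
    simp only [map_mul, map_add, map_sub, map_one, map_ofNat, map_pow]
    linear_combination (-4 * PowerSeries.C t * x) * h
  have hdx : PowerSeries.derivative R x = 1 := PowerSeries.derivative_X
  have hdc (c : R) : PowerSeries.derivative R (PowerSeries.C c) = 0 := PowerSeries.derivative_C
  have hd1 : PowerSeries.derivative R (G ^ 2) = -PowerSeries.C (2 * (1 + t)) +
      2 * PowerSeries.C ((1 - t) ^ 2) * x := by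
    rw [hsq]
    simp only [map_add, map_sub, Derivation.leibniz, Derivation.leibniz_pow, hdx, hdc,
      Derivation.map_one_eq_zero, smul_eq_mul, nsmul_eq_mul]
    push_cast
    ring
  have hd2 : PowerSeries.derivative R (G ^ 2) = 2 * G * PowerSeries.derivative R G := by
    rw [Derivation.leibniz_pow]
    simp only [smul_eq_mul, nsmul_eq_mul]
    push_cast
    ring
  have h20 : (PowerSeries.C (2 : R)) ≠ 0 := by
    rw [Ne, map_eq_zero_iff _ PowerSeries.C_injective]
    exact two_ne_zero
  -- With `D = G²`, this is `D G' = (D' / 2) G`: multiply `D' = 2 G G'` by `G`. It is linear in `G`,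
  -- so its coefficients give a recurrence.
  have hode : PowerSeries.derivative R G -
        PowerSeries.C (2 * (1 + t)) * (x * PowerSeries.derivative R G) +
        PowerSeries.C ((1 - t) ^ 2) * (x * (x * PowerSeries.derivative R G)) =
      PowerSeries.C (-(1 + t)) * G + PowerSeries.C ((1 - t) ^ 2) * (x * G) := by
    rw [hd1] at hd2
    apply mul_left_cancel₀ h20
    simp only [map_mul, map_add, map_sub, map_one, map_ofNat, map_pow, map_neg] at hsq hd2 ⊢
    linear_combination (-2 * PowerSeries.derivative R G) * hsq - G * hd2
  have hg (k : ℕ) : PowerSeries.coeff (k + 2) G = 2 * t * f (k + 1) := by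
    rw [hG, map_sub, map_add, PowerSeries.coeff_C_mul, PowerSeries.coeff_C_mul, hx,
      PowerSeries.coeff_succ_X_mul, PowerSeries.coeff_X, PowerSeries.coeff_one, hF,
      PowerSeries.coeff_mk]
    simp
  have hm := congrArg (PowerSeries.coeff (m + 2)) hode
  simp only [map_add, map_sub, PowerSeries.coeff_C_mul, hx, PowerSeries.coeff_succ_X_mul,
    PowerSeries.coeff_derivative] at hm
  rw [show m + 2 + 1 = (m + 1) + 2 from rfl, show m + 1 + 1 = m + 2 from rfl, hg, hg] at hm
  apply mul_left_cancel₀ (mul_ne_zero two_ne_zero ht)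
  -- For `m = 0` the linear coefficient of `G`, which `hg` does not cover, occurs equally on both
  -- sides and cancels.
  rcases m with _ | m
  · push_cast at hm ⊢
    simp only [zero_add] at hm ⊢
    linear_combination hm
  · rw [show m + 1 + 1 = m + 2 from rfl, hg] at hm
    push_cast at hm ⊢
    linear_combination hm

theorem natCast_mul_coeff_narayana (n d : ℕ) :
    (n : ℚ) * (narayana n).coeff d = n.choose d * n.choose (d + 1) := by
  rw [narayana, finsetSum_coeff]
  simp only [coeff_C_mul, coeff_X_pow, mul_ite, mul_one, mul_zero]
  rw [Finset.sum_ite_eq]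
  split_ifs with h
  · rw [Finset.mem_range] at h
    have : (n : ℚ) ≠ 0 := by exact_mod_cast (Nat.zero_lt_of_lt h).ne'
    field_simp
  · rw [Finset.mem_range, not_lt] at h
    rw [Nat.choose_eq_zero_of_lt (Nat.lt_succ_of_le h)]
    simp

theorem add_one_mul_choose_succ (m d : ℕ) :
    ((d : ℚ) + 1) * m.choose (d + 1) = (m - d) * m.choose d := by
  rcases le_or_gt d m with h | h
  · have := Nat.choose_succ_right_eq m d
    have h' : ((m - d : ℕ) : ℚ) = m - d := Nat.cast_sub h
    rw [← h', mul_comm, mul_comm ((m - d : ℕ) : ℚ)]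
    exact_mod_cast this
  · rw [Nat.choose_eq_zero_of_lt h, Nat.choose_eq_zero_of_lt (h.trans (Nat.lt_succ_self d))]
    simp

theorem narayana_recurrence (m : ℕ) :
    ((m : ℚ[X]) + 3) * narayana (m + 2) =
      (2 * (m : ℚ[X]) + 3) * (1 + X) * narayana (m + 1) -
        (m : ℚ[X]) * (1 - X) ^ 2 * narayana m := by
  have hc (k : ℕ) (P : ℚ[X]) (d : ℕ) : ((k : ℚ[X]) * P).coeff d = k * P.coeff d := by
    rw [← C_eq_natCast, coeff_C_mul]
  have expand : (2 * (m : ℚ[X]) + 3) * (1 + X) * narayana (m + 1) - (m : ℚ[X]) * (1 - X) ^ 2 * narayana m =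
      ((2 * m + 3 : ℕ) : ℚ[X]) * narayana (m + 1) +
        X * (((2 * m + 3 : ℕ) : ℚ[X]) * narayana (m + 1)) - ((m : ℚ[X]) * narayana m -
        X * (((2 : ℕ) : ℚ[X]) * ((m : ℚ[X]) * narayana m)) + X * (X * ((m : ℚ[X]) * narayana m))) := by
    push_cast
    ring
  rw [expand, show (m : ℚ[X]) + 3 = ((m + 3 : ℕ) : ℚ[X]) by push_cast; rfl]
  have n2 (d : ℕ) := natCast_mul_coeff_narayana (m + 2) d
  have n1 (d : ℕ) := natCast_mul_coeff_narayana (m + 1) d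
  have n0 (d : ℕ) := natCast_mul_coeff_narayana m d
  have r (d : ℕ) := add_one_mul_choose_succ m d
  have m1 : (m : ℚ) + 1 ≠ 0 := by positivity
  have m2 : (m : ℚ) + 2 ≠ 0 := by positivity
  ext d
  simp only [coeff_sub, coeff_add]
  -- The factors `m + 1` and `m + 2` clear the denominators in the coefficients of `narayana (m +
  -- 1)` and `narayana (m + 2)`.
  apply mul_left_cancel₀ m1
  apply mul_left_cancel₀ m2
  rcases d with _ | _ | d
  · simp only [hc, coeff_X_mul_zero, n0]
    have a2 := n2 0
    have a1 := n1 0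
    simp only [Nat.choose_zero_right, zero_add, Nat.choose_one_right] at a2 a1 ⊢
    push_cast at a2 a1 ⊢
    linear_combination (m + 3) * (m + 1 : ℚ) * a2 - (2 * m + 3) * (m + 2 : ℚ) * a1
  · simp only [hc, coeff_X_mul, coeff_X_mul_zero, n0, Nat.reduceAdd, zero_add]
    have a2 := n2 1
    have a1 := n1 1
    have a1' := n1 0
    simp only [Nat.choose_zero_right, zero_add, Nat.choose_one_right, Nat.reduceAdd,
      Nat.choose_succ_succ (m + 1) 1, Nat.choose_succ_succ m 1] at a2 a1 a1' ⊢
    push_cast at a2 a1 a1' ⊢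
    linear_combination (m + 3) * (m + 1 : ℚ) * a2 - (2 * m + 3) * (m + 2 : ℚ) * (a1 + a1')
  · simp only [hc, coeff_X_mul, n0]
    have a2 := n2 (d + 2)
    have a1 := n1 (d + 2)
    have a1' := n1 (d + 1)
    have r0 := r d
    have r1 := r (d + 1)
    have r2 := r (d + 2)
    simp only [Nat.choose_succ_succ, add_assoc, Nat.reduceAdd] at a2 a1 a1' r0 r1 r2 ⊢
    push_cast at a2 a1 a1' r0 r1 r2 ⊢
    generalize (m.choose d : ℚ) = c0 at *
    generalize (m.choose (d + 1) : ℚ) = c1 at *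
    generalize (m.choose (d + 2) : ℚ) = c2 at *
    generalize (m.choose (d + 3) : ℚ) = c3 at *
    have d1 : (d : ℚ) + 1 ≠ 0 := by positivity
    have d2 : (d : ℚ) + 2 ≠ 0 := by positivity
    have d3 : (d : ℚ) + 3 ≠ 0 := by positivity
    -- All binomials become rational multiples of `m.choose d`, which leaves an identity of rational
    -- functions.
    obtain rfl : c1 = (m - d) * c0 / (d + 1) := by
      field_simp; linear_combination r0
    obtain rfl : c2 = (m - (d + 1)) * ((m - d) * c0 / (d + 1)) / (d + 2) := by
      rw [eq_div_iff d2]; linear_combination r1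
    obtain rfl : c3 = (m - (d + 2)) * ((m - (d + 1)) * ((m - d) * c0 / (d + 1)) / (d + 2)) /
        (d + 3) := by
      rw [eq_div_iff d3]; linear_combination r2
    linear_combination (norm := skip)
      (m + 3) * (m + 1 : ℚ) * a2 - (2 * m + 3) * (m + 2 : ℚ) * (a1 + a1')
    field_simp
    ring

theorem treePoly_eq_narayana (n : ℕ) : treePoly (n + 1) = narayana (n + 1) := by
  have hne (m : ℕ) : (m : ℚ[X]) + 3 ≠ 0 := by
    exact_mod_cast (Nat.succ_ne_zero (m + 2))
  induction n using Nat.strong_induction_on with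
  | _ n ih =>
    rcases n with _ | _ | n
    · rw [treePoly_succ]
      simp [treePoly_zero, narayana]
    -- `treePoly 0 = 1` but `narayana 0 = 0`; the mismatch is harmless because at `m = 0` that term
    -- has coefficient zero.
    · have h1 := recurrence_of_quadratic X_ne_zero mk_treePoly_eq 0
      have h2 := narayana_recurrence 0
      rw [ih 0 (by omega)] at h1
      simp only [Nat.cast_zero, zero_mul, sub_zero] at h1 h2
      rw [← h2] at h1
      exact mul_left_cancel₀ (hne 0) (by simpa using h1)
    · have h1 := recurrence_of_quadratic X_ne_zero mk_treePoly_eq (n + 1)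
      have h2 := narayana_recurrence (n + 1)
      rw [ih n (by omega), ih (n + 1) (by omega), ← h2] at h1
      exact mul_left_cancel₀ (hne (n + 1)) h1

/-! ### Descents of lists. -/

/-- The number of descents of a list. -/
def listDes {α : Type*} [LinearOrder α] : List α → ℕ
  | [] => 0
  | [_] => 0
  | a :: b :: l => (if b < a then 1 else 0) + listDes (b :: l)

section

variable {α : Type*} [LinearOrder α]

theorem des_eq_listDes {n : ℕ} (w : Fin n → α) : des w = listDes (List.ofFn w) := by
  induction n with
  | zero => simp [des, listDes]
  | succ n ih =>
    rcases n with _ | n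
    · rw [des_eq_sum]
      simp [listDes]
    · have h := ih fun i => w i.succ
      rw [List.ofFn_succ, des_eq_sum] at h
      rw [des_eq_sum, Fin.sum_univ_succ, List.ofFn_succ, List.ofFn_succ, listDes, ← h]
      rfl

theorem listDes_append_cons {L R : List α} {M : α} (h : ∀ a ∈ L, a ≤ M) :
    listDes (L ++ M :: R) = listDes L + listDes (M :: R) := by
  induction L with
  | nil => simp [listDes]
  | cons a L ih =>
    have ih := ih fun x hx => h x (List.mem_cons_of_mem _ hx)
    rcases L with _ | ⟨b, L⟩
    · have := h a (by simp)
      simp [listDes, this.not_gt]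
    · rw [List.cons_append, List.cons_append, listDes, ← List.cons_append, ih, listDes, add_assoc]

theorem listDes_cons_of_head_lt {R : List α} {M : α} (h : ∀ a ∈ R.head?, a < M) :
    listDes (M :: R) = listDes R + if R.length = 0 then 0 else 1 := by
  rcases R with _ | ⟨a, R⟩
  · simp [listDes]
  · have := h a (by simp)
    simp [listDes, this, add_comm]

theorem listDes_cons_of_le_head {R : List α} {M : α} (h : ∀ a ∈ R.head?, M ≤ a) :
    listDes (M :: R) = listDes R := by
  rcases R with _ | ⟨a, R⟩
  · simp [listDes]
  · have := h a (by simp)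
    simp [listDes, this.not_gt]

end

/-! ### Dyck words as linear extensions of the rectangle. -/

/-- The word in `{false, true}` of a Dyck word, `true` standing for down steps. -/
def boolWord (p : DyckWord) : List Bool := p.toList.map (· == DyckStep.D)

theorem length_boolWord (p : DyckWord) : (boolWord p).length = 2 * p.semilength := by
  rw [boolWord, List.length_map, DyckWord.two_mul_semilength_eq_length]

theorem semilength_ofTree (T : BinaryTree Unit) : (DyckWord.ofTree T).semilength = T.numNodes := by
  rw [← DyckWord.numNodes_toTree, DyckWord.toTree_ofTree]

theorem head_boolWord (p : DyckWord) : ∀ a ∈ (boolWord p).head?, a = false := by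
  intro a ha
  by_cases h : p.toList = []
  · simp [boolWord, h] at ha
  · rw [boolWord, List.head?_map, List.head?_eq_some_head h, DyckWord.head_eq_U] at ha
    exact (Option.some.inj ha).symm

/-- A node gives the word `U l D r`. The only descent not inside `l` or `r` is at this `D`, and it
is there iff `r` is nonempty, because a nonempty Dyck word starts with `U`. -/
theorem listDes_boolWord_ofTree (T : BinaryTree Unit) :
    listDes (boolWord (DyckWord.ofTree T)) = rightCount T := by
  induction T with
  | nil => rfl
  | node a l r ihl ihr =>
    have : boolWord (DyckWord.ofTree (.node a l r)) =
        (false :: boolWord (DyckWord.ofTree l)) ++ true :: boolWord (DyckWord.ofTree r) := by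
      change (([DyckStep.U] ++ (DyckWord.ofTree l).toList ++ [DyckStep.D]) ++
        (DyckWord.ofTree r).toList).map _ = _
      simp [boolWord]
    rw [this, listDes_append_cons fun a _ => Bool.le_true a,
      listDes_cons_of_le_head fun a _ => Bool.false_le a, listDes_cons_of_head_lt,
      length_boolWord, semilength_ofTree, ihl, ihr, rightCount, add_assoc]
    · simp
    · intro a ha
      rw [head_boolWord _ a ha]
      decide

theorem count_take_ofFn {α : Type*} [DecidableEq α] {N : ℕ} (w : Fin N → α) (a : α) (i : ℕ) :
    ((List.ofFn w).take i).count a = Finset.card {k : Fin N | (k : ℕ) < i ∧ w k = a} := by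
  have h1 (l : List α) : l.count a = (l.map fun x => if x = a then 1 else 0).sum := by
    induction l with
    | nil => rfl
    | cons b l ih => simp [List.count_cons, ih, add_comm]
  rw [h1, List.map_take, List.map_ofFn, List.sum_take_ofFn, Finset.card_filter, Finset.sum_filter]
  refine Finset.sum_congr rfl fun k _ => ?_
  by_cases h : (k : ℕ) < i <;> simp [h]

/-- Step counts in a prefix become counts of columns, so that the ballot condition matches the
relations `(j, false) < (j, true)`. -/
theorem card_filter_snd_eq {n N : ℕ} (e : Fin N ≃ Fin n × Bool) (b : Bool) (i : ℕ) :
    Finset.card {k : Fin N | (k : ℕ) < i ∧ (e k).2 = b} =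
      Finset.card {j : Fin n | (e.symm (j, b) : ℕ) < i} := by
  refine Finset.card_nbij' (fun k => (e k).1) (fun j => e.symm (j, b)) ?_ ?_ ?_ ?_
  · intro k hk
    simp only [Finset.coe_filter, Finset.mem_univ, true_and, Set.mem_ofPred_eq] at hk ⊢
    have : ((e k).1, b) = e k := by rw [← hk.2]
    rw [this, e.symm_apply_apply]
    exact hk.1
  · intro j hj
    simpa using hj
  · intro k hk
    simp only [Finset.coe_filter, Finset.mem_univ, true_and, Set.mem_ofPred_eq] at hk
    have : ((e k).1, b) = e k := by rw [← hk.2]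
    simp [this]
  · intro j _
    simp

/-- The step of a Dyck path that a boolean stands for. -/
def stepOf (b : Bool) : DyckStep := if b then .D else .U

theorem stepOf_eq_D {b : Bool} : stepOf b = .D ↔ b = true := by cases b <;> simp [stepOf]

theorem stepOf_eq_U {b : Bool} : stepOf b = .U ↔ b = false := by cases b <;> simp [stepOf]

theorem symm_false_lt_symm_true {n N : ℕ} {e : Fin N ≃ Fin n × Bool}
    (he : e ∈ linExt (Fin n × Bool) N) (j : Fin n) : e.symm (j, false) < e.symm (j, true) :=
  mem_linExt.1 he (Prod.mk_lt_mk.2 (Or.inr ⟨le_rfl, by decide⟩))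

theorem symm_strictMono {n N : ℕ} {e : Fin N ≃ Fin n × Bool}
    (he : e ∈ linExt (Fin n × Bool) N) (b : Bool) : StrictMono fun j => e.symm (j, b) :=
  fun _ _ h => mem_linExt.1 he (Prod.mk_lt_mk.2 (Or.inl ⟨h, le_rfl⟩))

/-- The Dyck word of a linear extension of `Fin n × Bool`. -/
def dyckOfLinExt {n N : ℕ} (e : Fin N ≃ Fin n × Bool) (he : e ∈ linExt (Fin n × Bool) N) :
    DyckWord where
  toList := List.ofFn fun k => stepOf (e k).2
  count_U_eq_count_D := by
    have h (s : DyckStep) : (List.ofFn fun k => stepOf (e k).2).count s =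
        ((List.ofFn fun k => stepOf (e k).2).take N).count s := by
      rw [List.take_of_length_le (by simp)]
    rw [h, h, count_take_ofFn, count_take_ofFn]
    simp only [stepOf_eq_D, stepOf_eq_U]
    rw [card_filter_snd_eq, card_filter_snd_eq]
    simp
  count_D_le_count_U i := by
    rw [count_take_ofFn, count_take_ofFn]
    simp only [stepOf_eq_D, stepOf_eq_U]
    rw [card_filter_snd_eq, card_filter_snd_eq]
    refine Finset.card_le_card fun j hj => ?_
    simp only [Finset.mem_filter, Finset.mem_univ, true_and] at hj ⊢
    exact lt_trans (symm_false_lt_symm_true he j) hj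

theorem boolWord_dyckOfLinExt {n N : ℕ} (e : Fin N ≃ Fin n × Bool)
    (he : e ∈ linExt (Fin n × Bool) N) :
    boolWord (dyckOfLinExt e he) = List.ofFn fun k => (e k).2 := by
  rw [boolWord, dyckOfLinExt, List.map_ofFn]
  congr 1
  ext k
  cases h : (e k).2 <;> simp [stepOf, h]

/-- The word records only rows, but each row is enumerated in increasing order, so the set of its
positions determines it. -/
theorem dyckOfLinExt_injective {n N : ℕ} {e e' : Fin N ≃ Fin n × Bool}
    {he : e ∈ linExt (Fin n × Bool) N} {he' : e' ∈ linExt (Fin n × Bool) N}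
    (h : dyckOfLinExt e he = dyckOfLinExt e' he') : e = e' := by
  have h1 := congrArg boolWord h
  rw [boolWord_dyckOfLinExt, boolWord_dyckOfLinExt, List.ofFn_inj] at h1
  have range (e : Fin N ≃ Fin n × Bool) (b : Bool) :
      Set.range (fun j => e.symm (j, b)) = {k | (e k).2 = b} := by
    ext k
    constructor
    · rintro ⟨j, rfl⟩
      simp
    · intro hk
      exact ⟨(e k).1, by rw [e.symm_apply_eq]; exact Prod.ext rfl hk.symm⟩
  have h2 (b : Bool) : (fun j => e.symm (j, b)) = fun j => e'.symm (j, b) := by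
    rw [← StrictMono.range_inj (symm_strictMono he b) (symm_strictMono he' b), range, range]
    ext k
    exact Eq.congr (congrFun h1 k) rfl
  have h3 : e.symm = e'.symm := by
    ext x : 1
    exact congrFun (h2 x.2) x.1
  rw [← e.symm_symm, h3, e'.symm_symm]

theorem exists_dyckOfLinExt_eq (p : DyckWord) :
    ∃ e, ∃ he : e ∈ linExt (Fin p.semilength × Bool) (2 * p.semilength),
      dyckOfLinExt e he = p := by
  obtain ⟨n, hn⟩ : ∃ n, p.semilength = n := ⟨_, rfl⟩
  rw [hn]
  have hlen : p.toList.length = 2 * n := by rw [← hn, DyckWord.two_mul_semilength_eq_length]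
  let w : Fin (2 * n) → DyckStep := fun k => p.toList.get (k.cast hlen.symm)
  have hw : List.ofFn w = p.toList := by
    apply List.ext_get (by simp [hlen])
    intro i h1 h2
    simp [w]
  have hcount (b : Bool) : Finset.card {k | w k = stepOf b} = n := by
    have h := count_take_ofFn w (stepOf b) (2 * n)
    rw [hw, List.take_of_length_le hlen.le] at h
    simp only [Fin.is_lt, true_and] at h
    rw [← h, ← hn]
    cases b
    · rfl
    · exact DyckWord.semilength_eq_count_D.symm
  -- `pos b j` is the position of the `j`-th step of type `b`; it becomes the place of `(j, b)`.
  let pos (b : Bool) : Fin n ↪o Fin (2 * n) := Finset.orderEmbOfFin _ (hcount b)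
  have hpos (b : Bool) (j : Fin n) : w (pos b j) = stepOf b := by
    exact (Finset.mem_filter.1 (Finset.orderEmbOfFin_mem _ (hcount b) j)).2
  have hstep : Function.Injective stepOf := by decide
  let f : Fin n × Bool → Fin (2 * n) := fun x => pos x.2 x.1
  have hf : Function.Bijective f := by
    rw [Fintype.bijective_iff_injective_and_card]
    refine ⟨?_, by simp [mul_comm]⟩
    rintro ⟨i, a⟩ ⟨j, b⟩ h
    have hab : a = b := hstep (by rw [← hpos a i, ← hpos b j]; exact congrArg w h)
    subst hab
    exact Prod.ext ((pos a).injective h) rfl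
  let e : Fin (2 * n) ≃ Fin n × Bool := (Equiv.ofBijective f hf).symm
  have hsymm (j : Fin n) (b : Bool) : e.symm (j, b) = pos b j := rfl
  have hwe (k : Fin (2 * n)) : stepOf (e k).2 = w k := by
    rw [← hpos (e k).2 (e k).1, ← hsymm, Prod.mk.eta, e.symm_apply_apply]
  have hlt (j : Fin n) : pos false j < pos true j := by
    by_contra hle
    rw [not_lt] at hle
    have hne : pos true j ≠ pos false j := fun h => by
      have := (hpos true j).symm.trans ((congrArg w h).trans (hpos false j))
      exact absurd this (by decide)
    have hlt := lt_of_le_of_ne hle hne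
    -- The prefix ending at the `j`-th `D` (counted from zero) would hold at least `j + 1` steps `D`
    -- and at most `j` steps `U`.
    have h := p.count_D_le_count_U ((pos true j : ℕ) + 1)
    rw [← hw, count_take_ofFn, count_take_ofFn] at h
    simp only [← hwe, stepOf_eq_D, stepOf_eq_U] at h
    rw [card_filter_snd_eq, card_filter_snd_eq] at h
    have h1 : Finset.Iic j ⊆
        ({i : Fin n | (e.symm (i, true) : ℕ) < (pos true j : ℕ) + 1} : Finset (Fin n)) := by
      intro i hi
      rw [Finset.mem_Iic] at hi
      have := (pos true).monotone hi
      simpa [hsymm, Nat.lt_succ_iff] using this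
    have h2 : ({i : Fin n | (e.symm (i, false) : ℕ) < (pos true j : ℕ) + 1} : Finset (Fin n)) ⊆
        Finset.Iio j := by
      intro i hi
      rw [Finset.mem_Iio]
      have : pos false i ≤ pos true j := by simpa [hsymm, Nat.lt_succ_iff] using hi
      exact (pos false).lt_iff_lt.1 (this.trans_lt hlt)
    have h3 := Finset.card_le_card h1
    have h4 := Finset.card_le_card h2
    simp only [Fin.card_Iic, Fin.card_Iio] at h3 h4
    omega
  have he : e ∈ linExt (Fin n × Bool) (2 * n) := by
    rw [mem_linExt]
    rintro ⟨i, a⟩ ⟨j, b⟩ h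
    rw [hsymm, hsymm]
    have hle := h.le
    rw [Prod.mk_le_mk] at hle
    rcases hle.2.lt_or_eq with hab | rfl
    · obtain ⟨rfl, rfl⟩ : a = false ∧ b = true := by
        clear h hle
        revert a b
        decide
      exact (hlt i).trans_le ((pos true).monotone hle.1)
    · refine (pos a).strictMono ?_
      rcases Prod.mk_lt_mk.1 h with h | h
      · exact h.1
      · exact absurd h.2 (lt_irrefl _)
  refine ⟨e, he, DyckWord.ext ?_⟩
  rw [← hw]
  exact congrArg List.ofFn (funext hwe)

theorem semilength_dyckOfLinExt {n : ℕ} (e : Fin (2 * n) ≃ Fin n × Bool)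
    (he : e ∈ linExt (Fin n × Bool) (2 * n)) : (dyckOfLinExt e he).semilength = n := by
  have := (dyckOfLinExt e he).two_mul_semilength_eq_length
  simp only [dyckOfLinExt, List.length_ofFn] at this ⊢
  omega

/-- Neighbours in the same row appear in increasing order, so a descent must drop from row `true` to
row `false`: a valley of the path. -/
theorem des_naturalLabel {n N : ℕ} {e : Fin N ≃ Fin n × Bool}
    (he : e ∈ linExt (Fin n × Bool) N) :
    des (naturalLabel n ∘ e) = des fun k => (e k).2 := by
  rw [des, des]
  congr 1
  ext k
  simp only [Finset.mem_filter, Finset.mem_univ, true_and, Function.comp_apply, naturalLabel,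
    Prod.Lex.toLex_lt_toLex]
  refine exists_congr fun hk => or_iff_left ?_
  rintro ⟨h1, h2⟩
  have : e.symm (e ⟨k + 1, hk⟩) < e.symm (e k) :=
    mem_linExt.1 he (Prod.mk_lt_mk.2 (Or.inl ⟨h2, h1.le⟩))
  rw [e.symm_apply_apply, e.symm_apply_apply, Fin.lt_def] at this
  simp at this

theorem sum_linExt_naturalLabel (n : ℕ) :
    ∑ e ∈ linExt (Fin n × Bool) (2 * n), (X : ℚ[X]) ^ des (naturalLabel n ∘ e) = treePoly n := by
  refine Finset.sum_bij (fun e he => (dyckOfLinExt e he).toTree) ?_ ?_ ?_ ?_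
  · intro e he
    rw [BinaryTree.mem_treesOfNumNodesEq, DyckWord.numNodes_toTree, semilength_dyckOfLinExt]
  · intro e he e' he' h
    exact dyckOfLinExt_injective (DyckWord.equivTree.injective h)
  · intro T hT
    rw [BinaryTree.mem_treesOfNumNodesEq, ← semilength_ofTree] at hT
    subst hT
    obtain ⟨e, he, h⟩ := exists_dyckOfLinExt_eq (DyckWord.ofTree T)
    exact ⟨e, he, by rw [h, DyckWord.toTree_ofTree]⟩
  · intro e he
    rw [des_naturalLabel he, des_eq_listDes, ← boolWord_dyckOfLinExt e he,
      ← listDes_boolWord_ofTree, DyckWord.ofTree_toTree]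

/-! ### Trees and `132`-avoiding permutations. -/

/-- A list avoids the pattern `132`. -/
def ListAvoids (l : List ℕ) : Prop :=
  ∀ a b c, [a, b, c].Sublist l → a < c → ¬ c < b

/-- The `132`-avoiding arrangement of the numbers `o, o + 1, …` that corresponds to a tree. -/
def treeList : BinaryTree Unit → ℕ → List ℕ
  | .nil, _ => []
  | .node _ l r, o =>
    treeList l (o + r.numNodes) ++ (o + l.numNodes + r.numNodes) :: treeList r o

theorem length_treeList (T : BinaryTree Unit) (o : ℕ) : (treeList T o).length = T.numNodes := by
  induction T generalizing o with
  | nil => rfl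
  | node a l r ihl ihr =>
    simp only [treeList, List.length_append, List.length_cons, ihl, ihr, BinaryTree.numNodes]
    omega

theorem mem_treeList (T : BinaryTree Unit) (o x : ℕ) :
    x ∈ treeList T o ↔ o ≤ x ∧ x < o + T.numNodes := by
  induction T generalizing o with
  | nil => simp [treeList]
  | node a l r ihl ihr =>
    simp only [treeList, List.mem_append, List.mem_cons, ihl, ihr, BinaryTree.numNodes]
    omega

theorem nodup_treeList (T : BinaryTree Unit) (o : ℕ) : (treeList T o).Nodup := by
  induction T generalizing o with
  | nil => simp [treeList]
  | node a l r ihl ihr =>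
    rw [treeList, List.nodup_append, List.nodup_cons]
    refine ⟨ihl _, ⟨?_, ihr _⟩, ?_⟩
    · rw [mem_treeList]
      omega
    · intro x hx y hy
      rw [List.mem_cons] at hy
      rw [mem_treeList] at hx hy
      omega

/-- The maximum at the root is never the bottom of a descent, and is the top of one iff something
follows it: the recursion of `rightCount`. -/
theorem listDes_treeList (T : BinaryTree Unit) (o : ℕ) :
    listDes (treeList T o) = rightCount T := by
  induction T generalizing o with
  | nil => rfl
  | node a l r ihl ihr =>
    rw [treeList, listDes_append_cons, listDes_cons_of_head_lt, ihl, ihr, length_treeList,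
      rightCount, add_assoc]
    · intro x hx
      have := (mem_treeList _ _ _).1 (List.mem_of_mem_head? hx)
      omega
    · intro x hx
      have := (mem_treeList _ _ _).1 hx
      omega

theorem listAvoids_append_cons {L R : List ℕ} {M : ℕ} (hL : ListAvoids L) (hR : ListAvoids R)
    (hLM : ∀ x ∈ L, x < M) (hRM : ∀ x ∈ R, x < M) (hRL : ∀ x ∈ L, ∀ y ∈ R, y < x) :
    ListAvoids (L ++ M :: R) := by
  intro a b c h hac hcb
  rw [List.sublist_append_iff] at h
  obtain ⟨l₁, l₂, h, h1, h2⟩ := h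
  -- Cases by how many of the letters `a, b, c` fall in `L`.
  rcases l₁ with _ | ⟨a', _ | ⟨b', _ | ⟨c', l₁⟩⟩⟩
  · simp only [List.nil_append] at h
    subst h
    rcases List.sublist_cons_iff.1 h2 with h | ⟨r, hr, h⟩
    · exact hR a b c h hac hcb
    · simp only [List.cons.injEq] at hr
      obtain ⟨rfl, rfl⟩ := hr
      have := hRM b (h.subset (by simp))
      omega
  · simp only [List.cons_append, List.nil_append, List.cons.injEq] at h
    obtain ⟨rfl, rfl⟩ := h
    have hc : c ∈ R := by
      rcases List.sublist_cons_iff.1 h2 with h | ⟨r, hr, h⟩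
      · exact h.subset (by simp)
      · simp only [List.cons.injEq] at hr
        obtain ⟨rfl, rfl⟩ := hr
        exact h.subset (by simp)
    have := hRL a (h1.subset (by simp)) c hc
    omega
  · simp only [List.cons_append, List.nil_append, List.cons.injEq] at h
    obtain ⟨rfl, rfl, rfl⟩ := h
    have hc := h2.subset (List.mem_singleton_self c)
    rw [List.mem_cons] at hc
    rcases hc with rfl | hc
    · have := hLM b (h1.subset (by simp))
      omega
    · have := hRL a (h1.subset (by simp)) c hc
      omega
  · simp only [List.cons_append, List.cons.injEq] at h
    obtain ⟨rfl, rfl, rfl, h⟩ := h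
    obtain ⟨rfl, rfl⟩ := List.append_eq_nil_iff.1 h.symm
    exact hL a b c h1 hac hcb

theorem listAvoids_treeList (T : BinaryTree Unit) (o : ℕ) : ListAvoids (treeList T o) := by
  induction T generalizing o with
  | nil =>
    intro a b c h
    exact absurd h.length_le (by simp [treeList])
  | node a l r ihl ihr =>
    refine listAvoids_append_cons (ihl _) (ihr _) ?_ ?_ ?_ <;>
      simp only [mem_treeList] <;> intros <;> omega

/-- The maximum occurs only once, so both lists split there into the same left and right parts. -/
theorem treeList_injective {T T' : BinaryTree Unit} {o : ℕ} (h : treeList T o = treeList T' o) :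
    T = T' := by
  induction T generalizing o T' with
  | nil =>
    rcases T' with _ | ⟨a, l, r⟩
    · rfl
    · simp [treeList] at h
  | node a l r ihl ihr =>
    rcases T' with _ | ⟨a', l', r'⟩
    · simp [treeList] at h
    · have hlen := congrArg List.length h
      rw [length_treeList, length_treeList, BinaryTree.numNodes, BinaryTree.numNodes] at hlen
      rw [treeList, treeList, show o + l.numNodes + r.numNodes = o + l'.numNodes + r'.numNodes by
        omega, List.append_cons_inj_of_notMem] at h
      · obtain ⟨h1, -, h2⟩ := h
        have h3 := congrArg List.length h2
        rw [length_treeList, length_treeList] at h3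
        rw [h3] at h1
        rw [ihl h1, ihr h2]
      · rw [mem_treeList]
        omega
      · rw [mem_treeList]
        omega

theorem mem_iff_of_downward_closed {R : List ℕ} {o : ℕ} (hR : R.Nodup) (ho : ∀ x ∈ R, o ≤ x)
    (h : ∀ x ∈ R, ∀ y, o ≤ y → y < x → y ∈ R) (x : ℕ) :
    x ∈ R ↔ o ≤ x ∧ x < o + R.length := by
  have hcard := List.toFinset_card_of_nodup hR
  have hsub : R.toFinset ⊆ Finset.Ico o (o + R.length) := by
    intro x hx
    rw [List.mem_toFinset] at hx
    have : Finset.Ico o (x + 1) ⊆ R.toFinset := by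
      intro y hy
      rw [Finset.mem_Ico] at hy
      rw [List.mem_toFinset]
      rcases (Nat.lt_succ_iff.1 hy.2).lt_or_eq with h' | rfl
      · exact h x hx y hy.1 h'
      · exact hx
    have := Finset.card_le_card this
    rw [Nat.card_Ico, hcard] at this
    have := ho x hx
    rw [Finset.mem_Ico]
    omega
  have := Finset.eq_of_subset_of_card_le hsub (by simp [hcard])
  rw [← List.mem_toFinset, this, Finset.mem_Ico]

theorem ListAvoids.mono {l l' : List ℕ} (h : ListAvoids l') (hl : l.Sublist l') : ListAvoids l :=
  fun a b c h' => h a b c (h'.trans hl)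

/-- Split at the maximum `o + n`. Avoidance forces every letter after it below every letter before
it, so the right part fills the lower interval, the left part the upper one, and both are handled by
induction. -/
theorem exists_treeList_eq {l : List ℕ} {o n : ℕ} (hl : l.Nodup)
    (hmem : ∀ x, x ∈ l ↔ o ≤ x ∧ x < o + n) (ha : ListAvoids l) :
    ∃ T : BinaryTree Unit, T.numNodes = n ∧ treeList T o = l := by
  induction n using Nat.strong_induction_on generalizing l o with
  | _ n ih =>
    rcases n with _ | n
    · refine ⟨.nil, rfl, ?_⟩
      rw [treeList, eq_comm, List.eq_nil_iff_forall_not_mem]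
      intro x hx
      have := (hmem x).1 hx
      omega
    · obtain ⟨L, R, rfl⟩ := List.append_of_mem ((hmem (o + n)).2 (by omega))
      have hnd := hl
      rw [List.nodup_append, List.nodup_cons] at hnd
      obtain ⟨hL, ⟨hnR, hR⟩, hLR⟩ := hnd
      have hnL : o + n ∉ L := fun h => hLR _ h (o + n) (by simp) rfl
      simp only [List.mem_append, List.mem_cons] at hmem hLR
      have hlt (x : ℕ) (hx : x ∈ L) (y : ℕ) (hy : y ∈ R) : y < x := by
        have hne := hLR x hx y (Or.inr hy)
        by_contra hle
        refine ha x (o + n) y ?_ (by omega) ?_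
        · exact (List.singleton_sublist.2 hx).append
            ((List.singleton_sublist.2 hy).cons_cons (o + n))
        · have := (hmem y).1 (Or.inr (Or.inr hy))
          have : y ≠ o + n := fun h => hnR (h ▸ hy)
          omega
      have memR := mem_iff_of_downward_closed hR (o := o)
        (fun x hx => ((hmem x).1 (Or.inr (Or.inr hx))).1) (by
          intro x hx y hoy hyx
          have hx' := (hmem x).1 (Or.inr (Or.inr hx))
          rcases (hmem y).2 (by omega) with h | h | h
          · have := hlt y h x hx
            omega
          · omega
          · exact h)
      have hlen : L.length + R.length = n := by
        have h1 := List.toFinset_card_of_nodup hl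
        have h2 : (L ++ (o + n) :: R).toFinset = Finset.Ico o (o + (n + 1)) := by
          ext x
          rw [List.mem_toFinset, Finset.mem_Ico, ← hmem]
          simp
        rw [h2, Nat.card_Ico, List.length_append, List.length_cons] at h1
        omega
      have memL (x : ℕ) : x ∈ L ↔ o + R.length ≤ x ∧ x < o + R.length + L.length := by
        have h1 := hmem x
        have h2 := memR x
        constructor
        · intro hx
          have h3 := h1.1 (Or.inl hx)
          have h4 : x ≠ o + n := fun h => hnL (h ▸ hx)
          have h5 : x ∉ R := fun h => hLR x hx x (Or.inr h) rfl
          rw [h2] at h5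
          omega
        · intro hx
          rcases h1.2 (by omega) with h | h | h
          · exact h
          · omega
          · have := h2.1 h
            omega
      obtain ⟨TL, hTL, rfl⟩ := ih L.length (by omega) hL memL
        (ha.mono (List.sublist_append_left _ _))
      obtain ⟨TR, hTR, rfl⟩ := ih R.length (by omega) hR memR
        (ha.mono ((List.sublist_cons_self _ _).trans (List.sublist_append_right _ _)))
      rw [length_treeList] at hTL hTR
      simp only [length_treeList] at hlen ⊢
      refine ⟨.node () TL TR, ?_, ?_⟩
      · rw [BinaryTree.numNodes]
        omega
      · rw [treeList, ← hlen, add_assoc]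

/-- The permutation `132`. -/
def perm132 : Equiv.Perm (Fin 3) := Equiv.swap 1 2

theorem contains_perm132_iff {α : Type*} [LinearOrder α] {m : ℕ} {w : Fin m → α} :
    Contains w (perm132 : Fin 3 → Fin 3) ↔ ∃ i j k, i < j ∧ j < k ∧ w i < w k ∧ w k < w j := by
  constructor
  · rintro ⟨f, hf⟩
    exact ⟨f 0, f 1, f 2, f.strictMono (by decide), f.strictMono (by decide),
      (hf 0 2).1.2 (by decide), (hf 2 1).1.2 (by decide)⟩
  · rintro ⟨i, j, k, hij, hjk, h1, h2⟩
    refine ⟨OrderEmbedding.ofStrictMono ![i, j, k] ?_, ?_⟩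
    · rw [Fin.strictMono_iff_lt_succ]
      intro x
      fin_cases x <;> simpa
    · have h3 := h1.trans h2
      intro r s
      fin_cases r <;> fin_cases s <;>
        simp [perm132, h1, h2, h3, h1.not_gt, h2.not_gt, h3.not_gt, h1.ne, h2.ne, h3.ne,
          h1.ne', h2.ne', h3.ne', Equiv.swap_apply_def]

theorem listAvoids_ofFn {m : ℕ} {w : Fin m → ℕ} :
    ListAvoids (List.ofFn w) ↔ Avoids w (perm132 : Fin 3 → Fin 3) := by
  rw [Avoids, contains_perm132_iff]
  constructor
  · rintro h ⟨i, j, k, hij, hjk, h1, h2⟩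
    refine h _ _ _ ?_ h1 h2
    rw [List.sublist_iff_exists_fin_orderEmbedding_get_eq]
    have hm : m = (List.ofFn w).length := by simp
    refine ⟨(OrderEmbedding.ofStrictMono ![i, j, k] ?_).trans
      (Fin.castOrderIso hm).toOrderEmbedding, ?_⟩
    · rw [Fin.strictMono_iff_lt_succ]
      intro x
      fin_cases x <;> simpa
    · intro x
      fin_cases x <;> simp
  · rintro h a b c hs hac hcb
    rw [List.sublist_iff_exists_fin_orderEmbedding_get_eq] at hs
    obtain ⟨f, hf⟩ := hs
    have hm : (List.ofFn w).length = m := by simp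
    have h0 := hf 0
    have h1 := hf 1
    have h2 := hf 2
    simp only [List.get_ofFn] at h0 h1 h2
    refine h ⟨(f 0).cast hm, (f 1).cast hm, (f 2).cast hm,
      f.strictMono (show (0 : Fin 3) < 1 by decide), f.strictMono (show (1 : Fin 3) < 2 by decide),
      ?_, ?_⟩
    · rw [← h0, ← h2]; exact hac
    · rw [← h1, ← h2]; exact hcb

theorem avoids_comp_iff {α β γ : Type*} [LinearOrder α] [LinearOrder β] [LinearOrder γ] {m k : ℕ}
    {w : Fin m → α} {p : Fin k → β} {g : α → γ} (hg : StrictMono g) :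
    Avoids (g ∘ w) p ↔ Avoids w p := by
  simp only [Avoids, Contains, Function.comp_apply, hg.lt_iff_lt, hg.injective.eq_iff]

theorem des_comp {α β : Type*} [LinearOrder α] [LinearOrder β] {m : ℕ} (w : Fin m → α)
    {g : α → β} (hg : StrictMono g) : des (g ∘ w) = des w := by
  simp only [des, Function.comp_apply, hg.lt_iff_lt]

theorem exists_perm_ofFn_eq {n : ℕ} {l : List ℕ} (hl : l.Nodup) (hlen : l.length = n)
    (hlt : ∀ x ∈ l, x < n) : ∃ τ : Equiv.Perm (Fin n), List.ofFn (fun i => (τ i : ℕ)) = l := by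
  subst hlen
  let f : Fin l.length → Fin l.length := fun i => ⟨l.get i, hlt _ (List.get_mem _ _)⟩
  have hf : Function.Injective f := by
    intro i j h
    exact (List.nodup_iff_injective_get.1 hl) (congrArg Fin.val h)
  refine ⟨Equiv.ofBijective f (Finite.injective_iff_bijective.1 hf), ?_⟩
  exact List.ofFn_get l

theorem sum_permAvoiding_132 (n : ℕ) :
    ∑ τ ∈ permAvoiding n {perm132}, (X : ℚ[X]) ^ des (τ : Fin n → Fin n) = treePoly n := by
  classical
  let φ : Equiv.Perm (Fin n) → List ℕ := fun τ => List.ofFn (Fin.val ∘ τ)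
  have hφ : Function.Injective φ := by
    intro τ τ' h
    ext i
    exact congrFun (List.ofFn_injective h) i
  have h1 : ∑ τ ∈ permAvoiding n {perm132}, (X : ℚ[X]) ^ des (τ : Fin n → Fin n) =
      ∑ l ∈ (permAvoiding n {perm132}).image φ, X ^ listDes l := by
    rw [Finset.sum_image hφ.injOn]
    refine Finset.sum_congr rfl fun τ _ => ?_
    rw [← des_eq_listDes, des_comp _ Fin.val_strictMono]
  have h2 : treePoly n =
      ∑ l ∈ (BinaryTree.treesOfNumNodesEq n).image (treeList · 0), X ^ listDes l := by
    rw [Finset.sum_image fun T _ T' _ h => treeList_injective h, treePoly]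
    simp only [listDes_treeList]
  have hmem (τ : Equiv.Perm (Fin n)) : τ ∈ permAvoiding n {perm132} ↔ ListAvoids (φ τ) := by
    rw [listAvoids_ofFn, avoids_comp_iff Fin.val_strictMono]
    simp [permAvoiding]
  rw [h1, h2]
  congr 1
  ext l
  simp only [Finset.mem_image, hmem, BinaryTree.mem_treesOfNumNodesEq]
  constructor
  · rintro ⟨τ, hτ, rfl⟩
    refine exists_treeList_eq (List.nodup_ofFn.2 (Fin.val_injective.comp τ.injective)) ?_ hτ
    intro x
    simp only [φ, List.mem_ofFn, Function.comp_apply, zero_le, true_and, zero_add]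
    constructor
    · rintro ⟨i, rfl⟩
      exact (τ i).is_lt
    · intro hx
      exact ⟨τ.symm ⟨x, hx⟩, by simp⟩
  · rintro ⟨T, hT, rfl⟩
    obtain ⟨τ, hτ⟩ := exists_perm_ofFn_eq (nodup_treeList T 0)
      ((length_treeList T 0).trans hT) fun x hx => by
        have := (mem_treeList _ _ _).1 hx
        omega
    have hτ' : φ τ = treeList T 0 := hτ
    exact ⟨τ, hτ' ▸ listAvoids_treeList T 0, hτ'⟩

/-! ### Nonnesting permutations as shuffles of two copies of a permutation. -/

section

variable {n : ℕ}

/-- The shuffle of two copies of `τ` that is given by a linear extension of `Fin n × Bool`. -/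
def shuffleWord (τ : Equiv.Perm (Fin n)) (e : Fin (2 * n) ≃ Fin n × Bool) :
    Fin (2 * n) → Fin n := fun k => τ (e k).1

theorem shuffleWord_symm (τ : Equiv.Perm (Fin n)) (e : Fin (2 * n) ≃ Fin n × Bool) (i : Fin n)
    (b : Bool) : shuffleWord τ e (e.symm (i, b)) = τ i := by
  simp [shuffleWord]

/-- The row in the label matters only between two copies of one letter, and these occur in
increasing row order, creating no descent. -/
theorem des_shuffleWord (τ : Equiv.Perm (Fin n)) {e : Fin (2 * n) ≃ Fin n × Bool}
    (he : e ∈ linExt (Fin n × Bool) (2 * n)) :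
    des (shuffleWord τ e) = des (shuffleLabel τ ∘ e) := by
  rw [des, des]
  congr 1
  ext k
  rw [Finset.mem_filter_univ, Finset.mem_filter_univ]
  refine exists_congr fun hk => ?_
  simp only [Function.comp_apply, shuffleLabel, Prod.Lex.toLex_lt_toLex, shuffleWord]
  refine (or_iff_left ?_).symm
  rintro ⟨h1, h2⟩
  have : e.symm (e ⟨k + 1, hk⟩) < e.symm (e k) :=
    mem_linExt.1 he (Prod.mk_lt_mk.2 (Or.inr ⟨(τ.injective h1).le, h2⟩))
  rw [e.symm_apply_apply, e.symm_apply_apply, Fin.lt_def] at this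
  simp at this

theorem eq_symm_of_shuffleWord_eq {τ : Equiv.Perm (Fin n)} {e : Fin (2 * n) ≃ Fin n × Bool}
    (he : e ∈ linExt (Fin n × Bool) (2 * n)) {p q : Fin (2 * n)} (hpq : p < q)
    (h : shuffleWord τ e p = shuffleWord τ e q) :
    ∃ i, p = e.symm (i, false) ∧ q = e.symm (i, true) ∧ shuffleWord τ e p = τ i := by
  have h1 : (e p).1 = (e q).1 := τ.injective h
  refine ⟨(e p).1, ?_, ?_, rfl⟩ <;> rw [Equiv.eq_symm_apply]
  all_goals
    have hne : (e p).2 ≠ (e q).2 := fun h2 => hpq.ne (e.injective (Prod.ext h1 h2))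
    have hlt : (e p).2 < (e q).2 := by
      rcases hne.lt_or_gt with h2 | h2
      · exact h2
      · have : e.symm (e q) < e.symm (e p) :=
          mem_linExt.1 he (Prod.mk_lt_mk.2 (Or.inr ⟨h1.ge, h2⟩))
        simp only [e.symm_apply_apply] at this
        exact absurd this hpq.not_gt
    have : (e p).2 = false ∧ (e q).2 = true := by
      generalize (e p).2 = a at hlt
      generalize (e q).2 = b at hlt
      revert a b
      decide
  · exact Prod.ext rfl this.1
  · exact Prod.ext h1.symm this.2

theorem isDoublePerm_shuffleWord (τ : Equiv.Perm (Fin n)) (e : Fin (2 * n) ≃ Fin n × Bool) :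
    IsDoublePerm (shuffleWord τ e) := by
  intro l
  have : ({i : Fin (2 * n) | shuffleWord τ e i = l} : Finset _) =
      {e.symm (τ.symm l, false), e.symm (τ.symm l, true)} := by
    ext k
    rw [Finset.mem_filter_univ, Finset.mem_insert, Finset.mem_singleton, Equiv.eq_symm_apply,
      Equiv.eq_symm_apply, shuffleWord]
    constructor
    · rintro rfl
      cases h : (e k).2
      · exact Or.inl (Prod.ext (by simp) h)
      · exact Or.inr (Prod.ext (by simp) h)
    · rintro (h | h) <;> simp [h]
  rw [this, Finset.card_pair]
  simp

theorem contains_four_iff {α β : Type*} [LinearOrder α] [LinearOrder β] {m : ℕ} {w : Fin m → α}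
    {p : Fin 4 → β} :
    Contains w p ↔ ∃ i₀ i₁ i₂ i₃, i₀ < i₁ ∧ i₁ < i₂ ∧ i₂ < i₃ ∧
      ∀ r s : Fin 4, (w (![i₀, i₁, i₂, i₃] r) < w (![i₀, i₁, i₂, i₃] s) ↔ p r < p s) ∧
        (w (![i₀, i₁, i₂, i₃] r) = w (![i₀, i₁, i₂, i₃] s) ↔ p r = p s) := by
  constructor
  · rintro ⟨f, hf⟩
    refine ⟨f 0, f 1, f 2, f 3, f.strictMono (by decide), f.strictMono (by decide),
      f.strictMono (by decide), ?_⟩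
    have : ![f 0, f 1, f 2, f 3] = f := by
      ext x
      fin_cases x <;> rfl
    rw [this]
    exact hf
  · rintro ⟨i₀, i₁, i₂, i₃, h₀, h₁, h₂, h⟩
    refine ⟨OrderEmbedding.ofStrictMono ![i₀, i₁, i₂, i₃] ?_, h⟩
    rw [Fin.strictMono_iff_lt_succ]
    intro x
    fin_cases x <;> simpa

theorem contains_three_iff {α β : Type*} [LinearOrder α] [LinearOrder β] {m : ℕ} {w : Fin m → α}
    {p : Fin 3 → β} :
    Contains w p ↔ ∃ i₀ i₁ i₂, i₀ < i₁ ∧ i₁ < i₂ ∧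
      ∀ r s : Fin 3, (w (![i₀, i₁, i₂] r) < w (![i₀, i₁, i₂] s) ↔ p r < p s) ∧
        (w (![i₀, i₁, i₂] r) = w (![i₀, i₁, i₂] s) ↔ p r = p s) := by
  constructor
  · rintro ⟨f, hf⟩
    refine ⟨f 0, f 1, f 2, f.strictMono (by decide), f.strictMono (by decide), ?_⟩
    have : ![f 0, f 1, f 2] = f := by
      ext x
      fin_cases x <;> rfl
    rw [this]
    exact hf
  · rintro ⟨i₀, i₁, i₂, h₀, h₁, h⟩
    refine ⟨OrderEmbedding.ofStrictMono ![i₀, i₁, i₂] ?_, h⟩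
    rw [Fin.strictMono_iff_lt_succ]
    intro x
    fin_cases x <;> simpa

/-- An occurrence of `1221` or `2112` is a pair of distinct letters, the copies of one enclosing
the copies of the other. -/
theorem avoids_nesting_iff {α : Type*} [LinearOrder α] {m : ℕ} {w : Fin m → α} :
    (Avoids w (![1, 2, 2, 1] : Fin 4 → ℕ) ∧ Avoids w (![2, 1, 1, 2] : Fin 4 → ℕ)) ↔
      ∀ i₀ i₁ i₂ i₃, i₀ < i₁ → i₁ < i₂ → i₂ < i₃ → w i₀ = w i₃ → w i₁ = w i₂ → w i₀ = w i₁ := by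
  rw [Avoids, Avoids, contains_four_iff, contains_four_iff]
  constructor
  · rintro ⟨h1, h2⟩ i₀ i₁ i₂ i₃ h₀ h₁ h₂ e1 e2
    by_contra hne
    rcases lt_or_gt_of_ne hne with h | h
    · refine h1 ⟨i₀, i₁, i₂, i₃, h₀, h₁, h₂, ?_⟩
      intro r s
      fin_cases r <;> fin_cases s <;> simp [← e1, ← e2, h, h.not_gt, h.ne, h.ne']
    · refine h2 ⟨i₀, i₁, i₂, i₃, h₀, h₁, h₂, ?_⟩
      intro r s
      fin_cases r <;> fin_cases s <;> simp [← e1, ← e2, h, h.not_gt, h.ne, h.ne']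
  · intro h
    constructor
    all_goals
      rintro ⟨i₀, i₁, i₂, i₃, h₀, h₁, h₂, hp⟩
      have e1 := (hp 0 3).2.2 rfl
      have e2 := (hp 1 2).2.2 rfl
      have e3 := (hp 0 1).2.1 (h i₀ i₁ i₂ i₃ h₀ h₁ h₂ e1 e2)
      simp at e3

theorem isNonnesting_shuffleWord (τ : Equiv.Perm (Fin n)) {e : Fin (2 * n) ≃ Fin n × Bool}
    (he : e ∈ linExt (Fin n × Bool) (2 * n)) : IsNonnesting (shuffleWord τ e) := by
  refine ⟨isDoublePerm_shuffleWord τ e, avoids_nesting_iff.2 ?_⟩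
  intro i₀ i₁ i₂ i₃ h₀ h₁ h₂ e1 e2
  obtain ⟨i, rfl, rfl, -⟩ := eq_symm_of_shuffleWord_eq he (h₀.trans (h₁.trans h₂)) e1
  obtain ⟨j, rfl, rfl, -⟩ := eq_symm_of_shuffleWord_eq he h₁ e2
  -- Nesting would order columns `i`, `j` one way by first copies and the other way by second
  -- copies.
  exact absurd ((symm_strictMono he false).lt_iff_lt.1 h₀)
    ((symm_strictMono he true).lt_iff_lt.1 h₂).not_gt

theorem exists_first_second {π : Fin (2 * n) → Fin n} (hπ : IsDoublePerm π) :
    ∃ P : Fin n → Bool → Fin (2 * n), (∀ l, P l false < P l true) ∧ ∀ l b, π (P l b) = l := by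
  have (l : Fin n) : ∃ Q : Bool → Fin (2 * n), Q false < Q true ∧ ∀ b, π (Q b) = l := by
    obtain ⟨x, y, hxy, h⟩ := Finset.card_eq_two.1 (hπ l)
    have hx : x ∈ ({i : Fin (2 * n) | π i = l} : Finset _) := by simp [h]
    have hy : y ∈ ({i : Fin (2 * n) | π i = l} : Finset _) := by simp [h]
    simp only [Finset.mem_filter, Finset.mem_univ, true_and] at hx hy
    rcases hxy.lt_or_gt with hlt | hlt
    · exact ⟨fun b => if b then y else x, by simpa, by simp [hx, hy]⟩
    · exact ⟨fun b => if b then x else y, by simpa, by simp [hx, hy]⟩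
  choose P hP using this
  exact ⟨P, fun l => (hP l).1, fun l => (hP l).2⟩

theorem exists_shuffleWord_eq {π : Fin (2 * n) → Fin n} (hπ : IsNonnesting π) :
    ∃ τ, ∃ e ∈ linExt (Fin n × Bool) (2 * n), shuffleWord τ e = π := by
  obtain ⟨P, hP, hPπ⟩ := exists_first_second hπ.1
  have hnest := avoids_nesting_iff.1 hπ.2
  have hinj (b : Bool) : Function.Injective fun l => P l b := fun l l' h => by
    rw [← hPπ l b, ← hPπ l' b]
    exact congrArg π h
  -- `τ` lists the letters by first occurrence; `htrue` derives from nonnesting that second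
  -- occurrences follow the same order.
  obtain ⟨τ, hτ⟩ := exists_equiv_strictMono (Fintype.card_fin n) (hinj false)
  have htrue (l l' : Fin n) (h : P l false < P l' false) : P l true < P l' true := by
    by_contra hle
    rw [not_lt] at hle
    have hne : l ≠ l' := fun h' => h.ne (by rw [h'])
    have hlt : P l' true < P l true := lt_of_le_of_ne hle ((hinj true).ne hne.symm)
    have := hnest _ _ _ _ h (hP l') hlt (by rw [hPπ, hPπ]) (by rw [hPπ, hPπ])
    rw [hPπ, hPπ] at this
    exact hne this
  let f : Fin n × Bool → Fin (2 * n) := fun x => P (τ x.1) x.2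
  have hf : Function.Bijective f := by
    rw [Fintype.bijective_iff_injective_and_card]
    refine ⟨?_, by simp [mul_comm]⟩
    rintro ⟨i, a⟩ ⟨j, b⟩ h
    have hij : τ i = τ j := by
      rw [← hPπ (τ i) a, ← hPπ (τ j) b]
      exact congrArg π h
    obtain rfl := τ.injective hij
    have h' : P (τ i) a = P (τ i) b := h
    have hne := (hP (τ i)).ne
    cases a <;> cases b <;> first | rfl | exact absurd h' hne | exact absurd h'.symm hne
  let e : Fin (2 * n) ≃ Fin n × Bool := (Equiv.ofBijective f hf).symm
  have hsymm (x : Fin n × Bool) : e.symm x = P (τ x.1) x.2 := rfl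
  refine ⟨τ, e, ?_, ?_⟩
  · rw [mem_linExt]
    rintro ⟨i, a⟩ ⟨j, b⟩ h
    rw [hsymm, hsymm]
    have hrow (b : Bool) (i j : Fin n) (hij : i < j) : P (τ i) b < P (τ j) b := by
      cases b
      · exact hτ hij
      · exact htrue _ _ (hτ hij)
    have hle := h.le
    rw [Prod.mk_le_mk] at hle
    rcases hle.2.lt_or_eq with hab | rfl
    · obtain ⟨rfl, rfl⟩ : a = false ∧ b = true := by
        clear h hle
        revert a b
        decide
      refine (hP (τ i)).trans_le ?_
      rcases hle.1.lt_or_eq with hij | hij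
      · exact (hrow true i j hij).le
      · exact (congrArg (fun k => P (τ k) true) hij).le
    · rcases Prod.mk_lt_mk.1 h with h | h
      · exact hrow a i j h.1
      · exact absurd h.2 (lt_irrefl _)
  · ext k : 1
    obtain ⟨x, rfl⟩ := e.symm.surjective k
    rw [hsymm, hPπ, ← hsymm]
    simp [shuffleWord]

theorem shuffleWord_injective {τ τ' : Equiv.Perm (Fin n)} {e e' : Fin (2 * n) ≃ Fin n × Bool}
    (he : e ∈ linExt (Fin n × Bool) (2 * n)) (he' : e' ∈ linExt (Fin n × Bool) (2 * n))
    (h : shuffleWord τ e = shuffleWord τ' e') : τ = τ' ∧ e = e' := by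
  have key (l : Fin n) : e.symm (τ.symm l, false) = e'.symm (τ'.symm l, false) ∧
      e.symm (τ.symm l, true) = e'.symm (τ'.symm l, true) := by
    obtain ⟨i, h1, h2, h3⟩ := eq_symm_of_shuffleWord_eq (τ := τ') he'
      (symm_false_lt_symm_true he (τ.symm l))
      (by rw [← h, shuffleWord_symm, shuffleWord_symm])
    rw [← h, shuffleWord_symm, Equiv.apply_symm_apply] at h3
    obtain rfl : i = τ'.symm l := by rw [h3, Equiv.symm_apply_apply]
    exact ⟨h1, h2⟩
  have hinj : Function.Injective fun l => e.symm (τ.symm l, false) := by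
    intro l l' h
    simpa using h
  have hτ : τ = τ' := by
    refine equiv_eq_of_strictMono hinj ?_ ?_
    · intro i j hij
      simpa using symm_strictMono he false hij
    · intro i j hij
      simp only [Function.comp_apply, (key _).1]
      simpa using symm_strictMono he' false hij
  subst hτ
  refine ⟨rfl, ?_⟩
  have : e.symm = e'.symm := by
    ext x : 1
    have h1 := key (τ x.1)
    rw [Equiv.symm_apply_apply] at h1
    rcases x with ⟨i, b⟩
    cases b
    · exact h1.1
    · exact h1.2
  rw [← e.symm_symm, this, e'.symm_symm]

/-- The doubled letter of an occurrence takes up both copies of some column `j`. Whatever precedes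
the first copy lies in an earlier column, and whatever follows the second in a later one.
Conversely, take the first copy of `i`, both of `j` and the second of `k`. -/
theorem contains_doubleMiddle_iff (τ : Equiv.Perm (Fin n)) {e : Fin (2 * n) ≃ Fin n × Bool}
    (he : e ∈ linExt (Fin n × Bool) (2 * n)) (σ : Equiv.Perm (Fin 3)) :
    Contains (shuffleWord τ e) (doubleMiddle σ) ↔
      Contains (τ : Fin n → Fin n) (σ : Fin 3 → Fin 3) := by
  rw [contains_four_iff, contains_three_iff]
  constructor
  · rintro ⟨p₀, p₁, p₂, p₃, h₀, h₁, h₂, h⟩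
    obtain ⟨j, rfl, rfl, hj⟩ := eq_symm_of_shuffleWord_eq he h₁ ((h 1 2).2.2 rfl)
    have hmono := (mem_linExt.1 he).monotone
    have hij : (e p₀).1 < j := by
      by_contra hle
      refine h₀.not_ge ?_
      rw [← e.symm_apply_apply p₀]
      exact hmono (Prod.mk_le_mk.2 ⟨not_lt.1 hle, Bool.false_le _⟩)
    have hjk : j < (e p₃).1 := by
      by_contra hle
      refine h₂.not_ge ?_
      rw [← e.symm_apply_apply p₃]
      exact hmono (Prod.mk_le_mk.2 ⟨not_lt.1 hle, Bool.le_true _⟩)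
    refine ⟨(e p₀).1, j, (e p₃).1, hij, hjk, ?_⟩
    have hv : ∀ r : Fin 3, τ (![(e p₀).1, j, (e p₃).1] r) = shuffleWord τ e
        (![p₀, e.symm (j, false), e.symm (j, true), p₃] (![0, 1, 3] r)) := by
      intro r
      fin_cases r
      · rfl
      · exact hj.symm
      · rfl
    have hd : ∀ r : Fin 3, σ r = doubleMiddle σ (![0, 1, 3] r) := by
      intro r
      fin_cases r <;> rfl
    intro r s
    rw [hv, hv, hd r, hd s]
    exact h _ _
  · rintro ⟨i, j, k, hij, hjk, h⟩
    refine ⟨e.symm (i, false), e.symm (j, false), e.symm (j, true), e.symm (k, true),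
      symm_strictMono he false hij, symm_false_lt_symm_true he j, symm_strictMono he true hjk, ?_⟩
    have hv : ∀ r : Fin 4, shuffleWord τ e (![e.symm (i, false), e.symm (j, false),
        e.symm (j, true), e.symm (k, true)] r) = τ (![i, j, k] (![0, 1, 1, 2] r)) := by
      intro r
      fin_cases r <;> exact shuffleWord_symm _ _ _ _
    have hd : ∀ r : Fin 4, doubleMiddle σ r = σ (![0, 1, 1, 2] r) := by
      intro r
      fin_cases r <;> rfl
    intro r s
    rw [hv, hv, hd r, hd s]
    exact h _ _

theorem mem_nonnestingAvoiding {β : Type*} [LinearOrder β] {k : ℕ} {Λ : Set (Fin k → β)}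
    {π : Fin (2 * n) → Fin n} :
    π ∈ nonnestingAvoiding n Λ ↔ IsNonnesting π ∧ ∀ p ∈ Λ, Avoids π p := by
  simp [nonnestingAvoiding]

theorem mem_permAvoiding {k : ℕ} {S : Set (Equiv.Perm (Fin k))} {τ : Equiv.Perm (Fin n)} :
    τ ∈ permAvoiding n S ↔ ∀ σ ∈ S, Avoids (τ : Fin n → Fin n) (σ : Fin k → Fin k) := by
  simp [permAvoiding]

theorem sum_nonnestingAvoiding (n : ℕ) (S : Set (Equiv.Perm (Fin 3))) :
    ∑ π ∈ nonnestingAvoiding n (doubleMiddle '' S), (X : ℚ[X]) ^ des π =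
      ∑ τ ∈ permAvoiding n S, ∑ e ∈ linExt (Fin n × Bool) (2 * n),
        (X : ℚ[X]) ^ des (shuffleLabel τ ∘ e) := by
  rw [← Finset.sum_product']
  symm
  have hav {τ : Equiv.Perm (Fin n)} {e : Fin (2 * n) ≃ Fin n × Bool}
      (he : e ∈ linExt (Fin n × Bool) (2 * n)) :
      shuffleWord τ e ∈ nonnestingAvoiding n (doubleMiddle '' S) ↔ τ ∈ permAvoiding n S := by
    rw [mem_nonnestingAvoiding, mem_permAvoiding, and_iff_right (isNonnesting_shuffleWord τ he),
      Set.forall_mem_image]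
    simp only [Avoids, contains_doubleMiddle_iff τ he]
  refine Finset.sum_bij (fun p _ => shuffleWord p.1 p.2) ?_ ?_ ?_ ?_
  · rintro ⟨τ, e⟩ h
    rw [Finset.mem_product] at h
    exact (hav h.2).2 h.1
  · rintro ⟨τ, e⟩ h ⟨τ', e'⟩ h' heq
    rw [Finset.mem_product] at h h'
    obtain ⟨h1, h2⟩ := shuffleWord_injective h.2 h'.2 heq
    exact Prod.ext h1 h2
  · intro π hπ
    obtain ⟨τ, e, he, rfl⟩ := exists_shuffleWord_eq (mem_nonnestingAvoiding.1 hπ).1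
    exact ⟨(τ, e), Finset.mem_product.2 ⟨(hav he).1 hπ, he⟩, rfl⟩
  · rintro ⟨τ, e⟩ h
    rw [Finset.mem_product] at h
    rw [des_shuffleWord τ h.2]

/-! ### Assembly, and the pattern `1332`. -/

theorem sum_nonnestingAvoiding_doubleMiddle (hn : 1 ≤ n) (S : Set (Equiv.Perm (Fin 3))) :
    ∑ π ∈ nonnestingAvoiding n (doubleMiddle '' S), (X : ℚ[X]) ^ des π =
      narayana n * ∑ τ ∈ permAvoiding n S, (X : ℚ[X]) ^ des (τ : Fin n → Fin n) := by
  rw [sum_nonnestingAvoiding, Finset.mul_sum]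
  refine Finset.sum_congr rfl fun τ _ => ?_
  obtain ⟨m, rfl⟩ := Nat.exists_eq_add_of_le' hn
  rw [sum_linExt_shuffleLabel hn τ.injective, sum_linExt_naturalLabel, treePoly_eq_narayana,
    mul_comm]

theorem avoids_1332_iff {m : ℕ} {α : Type*} [LinearOrder α] {w : Fin m → α} :
    Avoids w (![1, 3, 3, 2] : Fin 4 → ℕ) ↔ Avoids w (doubleMiddle perm132) := by
  have (r s : Fin 4) : ((![1, 3, 3, 2] : Fin 4 → ℕ) r < (![1, 3, 3, 2] : Fin 4 → ℕ) s ↔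
      doubleMiddle perm132 r < doubleMiddle perm132 s) ∧
      ((![1, 3, 3, 2] : Fin 4 → ℕ) r = (![1, 3, 3, 2] : Fin 4 → ℕ) s ↔
      doubleMiddle perm132 r = doubleMiddle perm132 s) := by
    revert r s
    decide
  simp only [Avoids, Contains, fun r s => (this r s).1, fun r s => (this r s).2]

theorem nonnestingAvoiding_1332 (n : ℕ) :
    nonnestingAvoiding n ({![1, 3, 3, 2]} : Set (Fin 4 → ℕ)) =
      nonnestingAvoiding n (doubleMiddle '' {perm132}) := by
  ext π
  simp [mem_nonnestingAvoiding, avoids_1332_iff]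

end

end NonnestingPerm

theorem mainTheorem10 (n : ℕ) (hn : 1 ≤ n) :
    (∀ S : Set (Equiv.Perm (Fin 3)),
      ∑ π ∈ NonnestingPerm.nonnestingAvoiding n (NonnestingPerm.doubleMiddle '' S),
          (X : ℚ[X]) ^ NonnestingPerm.des π =
        NonnestingPerm.narayana n *
          ∑ τ ∈ NonnestingPerm.permAvoiding n S,
            (X : ℚ[X]) ^ NonnestingPerm.des (τ : Fin n → Fin n)) ∧
    ∑ π ∈ NonnestingPerm.nonnestingAvoiding n ({![1, 3, 3, 2]} : Set (Fin 4 → ℕ)),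
        (X : ℚ[X]) ^ NonnestingPerm.des π =
      NonnestingPerm.narayana n ^ 2 := by
  refine ⟨NonnestingPerm.sum_nonnestingAvoiding_doubleMiddle hn, ?_⟩
  rw [NonnestingPerm.nonnestingAvoiding_1332, NonnestingPerm.sum_nonnestingAvoiding_doubleMiddle hn,
    NonnestingPerm.sum_permAvoiding_132]
  obtain ⟨m, rfl⟩ := Nat.exists_eq_add_of_le' hn
  rw [NonnestingPerm.treePoly_eq_narayana, sq]
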